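/- **Setting.** Let $\mathrm{Reg}_a=(\mathbb C^2)^{\otimes a}$ and $\sigma_m=I/2^m$ on $m$ qubits. A function $\mu:\mathbb N\to\mathbb R_{>0}$ is negligible if for every $c\in\mathbb N$ one has $\mu(n)<n^{-c}$ for all large $n$. A QPT algorithm is a family (indexed by $n$) of quantum circuits over the gate set $\{H,T,\mathrm{CNOT}\}$ with polynomially many gates and $|0\rangle$-ancillas, acting on an input state of polynomially many qubits and followed by a measurement of one qubit. The initial (input) states of an adversary are arbitrary, i.e. QPT adversaries are non-uniform and may hold an arbitrary quantum advice state; this convention is used both in the pseudorandomness assumption and in the conclusion. A QPT oracle algorithm may in addition apply the oracle unitary as a gate. A keyed family of unitaries $W_k$ is efficiently implementable if some polynomial-size circuit family outputs, on input any key $k$ and any pure state $\psi$, the state $W_k\psi$ with fidelity at least $1-\mathrm{negl}(n)$. **Pseudorandom unitaries.** A family $V_k$, $k\in\{0,1\}^{\lambda(n)}$, of $z(n)$-qubit unitaries, with $\lambda(n)$ and $n$ polynomially related, is a PRU if it is efficiently implementable and, for every QPT oracle algorithm $\mathcal A$, $\left|\Pr_{k}[\mathcal A^{V_k}=1]-\Pr_{U\sim\mathrm{Haar}}[\mathcal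 A^{U}=1]\right|\le\mathrm{negl}(\lambda(n))$. **PQAS.** Let $\ell(n),m(n)$ be polynomially bounded, $\ell,m=\omega(\log n)$, and $z=n+\ell+m$. Let $V^{(1)}_{k_1}$ be a PRU on $z$ qubits, $V^{(2)}_{k_2}$ an approximate unitary $4$-design of relative error $2^{-2m-\mathrm{polylog}(n)}$, and $V^{(3)}_{k_3}$ an exact unitary $2$-design, with keys $k_i$ uniform over bit strings of length $\lambda_i(n)$, where $\lambda=\lambda_1+\lambda_2+\lambda_3$ is polynomially bounded. (An ensemble is an approximate $t$-design of relative error $\epsilon$ if $\Phi_{\mathcal E}-(1-\epsilon)\Phi_{\rm Haar}$ and $(1+\epsilon)\Phi_{\rm Haar}-\Phi_{\mathcal E}$ are completely positive, where $\Phi(X)=\mathbb E_U[U^{\otimes t}XU^{\dagger\otimes t}]$; it is exact if $\epsilon=0$.) Assume that the family $U_k=V^{(1)}_{k_1}V^{(2)}_{k_2}V^{(3)}_{k_3}$, $k=(k_1,k_2,k_3)\in\{0,1\}^{\lambda(n)}$, is efficiently implementable. The PQAS encrypts an $n$-qubit state by $$\Phi_k(\rho)=U_k\left(\rho\otimes|0\rangle\langle0|^{\otimes\ell}\otimes\sigma_m\right)U_k^\dagger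 .$$ **Left-or-right experiment.** For a state $\rho_{\rm in}$ of a left and a right $n$-qubit register, $\mathrm{LR}_{k,0}(\rho_{\rm in})=\mathrm{tr}_{\rm right}\big((\Phi_k\otimes I)(\rho_{\rm in})\big)$ and $\mathrm{LR}_{k,1}(\rho_{\rm in})=\mathrm{tr}_{\rm left}\big((I\otimes\Phi_k)(\rho_{\rm in})\big)$. A non-adaptive adversary $\mathcal A$ with $t=\mathrm{poly}(n)$ queries holds an arbitrary (possibly entangled) state $\rho_{\rm g}$ of $t$ pairs of $n$-qubit registers and of $r=\mathrm{poly}(n)$ further qubits (such as $r=2tq$ purifying qubits). A uniformly random key $k\in\{0,1\}^\lambda$ and a bit $b$ are chosen, the $t$ pairs are sent through $\mathrm{LR}_{k,b}^{\otimes t}$, and $\mathcal A$ runs a QPT algorithm on $(\mathrm{LR}_{k,b}^{\otimes t}\otimes I)(\rho_{\rm g})$, which outputs a bit $b'$. **Theorem (non-adaptive CPA-security of PQAS).** For every PQAS and every such adversary $\mathcal A$ (with arbitrary polynomially bounded $t,r$ and arbitrary states $\rho_{\rm g}$), $$\left|\Pr_{k}\big[\mathcal A((\mathrm{LR}_{k,0}^{\otimes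 t}\otimes I)(\rho_{\rm g}))=1\big]-\Pr_{k}\big[\mathcal A((\mathrm{LR}_{k,1}^{\otimes t}\otimes I)(\rho_{\rm g}))=1\big]\right|\le\mathrm{negl}(\lambda(n)),$$ and, for uniformly random $b$, the adversary's success probability satisfies $\Pr[b'=b]\le\frac12+\mathrm{negl}(\lambda(n))$. -/

import Mathlib

open scoped Matrix Kronecker ComplexOrder
open MeasureTheory Filter

noncomputable section

namespace QCrypto

/-! ## Asymptotics -/

/-- Bounded by a polynomial. -/
def PolyBounded (f : ℕ → ℕ) : Prop :=
  ∃ p : Polynomial ℕ, ∀ n, f n ≤ p.eval n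

/-- A positive function that is eventually below every inverse polynomial. -/
def Negligible (μ : ℕ → ℝ) : Prop :=
  (∀ n, 0 < μ n) ∧ ∀ c : ℕ, ∃ n₀ : ℕ, ∀ n, n₀ < n → μ n < ((n : ℝ) ^ c)⁻¹

/-- `f n ≤ negl (s n)` for some negligible function `negl`. -/
def NegligibleIn (s : ℕ → ℕ) (f : ℕ → ℝ) : Prop :=
  ∃ μ : ℕ → ℝ, Negligible μ ∧ ∀ n, f n ≤ μ (s n)

/-- `f = ω(log n)`. -/
def SuperLogarithmic (f : ℕ → ℕ) : Prop :=
  (fun n : ℕ => Real.log n) =o[atTop] (fun n : ℕ => (f n : ℝ))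

/-- `f = polylog(n)`. -/
def PolyLog (f : ℕ → ℝ) : Prop :=
  ∃ c : ℕ, ∃ C : ℝ, ∀ n, 0 ≤ f n ∧ f n ≤ C * Real.log (n + 2) ^ c

/-! ## Registers of qubits, operators, states -/

/-- The computational basis of a register of qubits whose wires are labelled by `ι`. -/
abbrev Reg (ι : Type) : Type := ι → Bool

/-- Operators on the Hilbert space of the register `ι`. -/
abbrev Op (ι : Type) : Type := Matrix (Reg ι) (Reg ι) ℂ

/-- The unitary group of the register `ι`. -/
abbrev QU (ι : Type) [Fintype ι] [DecidableEq ι] := Matrix.unitaryGroup (Reg ι) ℂ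

/-- Density matrices: positive semidefinite of trace one. -/
def IsDensity {α : Type} [Fintype α] (ρ : Matrix α α ℂ) : Prop :=
  ρ.PosSemidef ∧ ρ.trace = 1

/-- The operator that acts as `M` on the wires `w` (assumed distinct) and trivially on all other
wires. -/
def onWires {κ ι : Type} [Fintype κ] [Fintype ι] [DecidableEq ι] (w : κ → ι) (M : Op κ) : Op ι :=
  Matrix.of fun x y => if ∀ i, (∀ j, w j ≠ i) → x i = y i then M (x ∘ w) (y ∘ w) else 0

/-- `ρ ⊗ |0…0⟩⟨0…0|` with `a` ancilla qubits. -/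
def withAncillas {ι : Type} (a : ℕ) (ρ : Op ι) : Op (ι ⊕ Fin a) :=
  Matrix.of fun x y =>
    if ∀ j : Fin a, x (Sum.inr j) = false ∧ y (Sum.inr j) = false then
      ρ (x ∘ Sum.inl) (y ∘ Sum.inl)
    else 0

/-! ## Haar measure on the unitary group -/

section Haar

variable (ι : Type) [Fintype ι] [DecidableEq ι]

instance : CompactSpace (QU ι) := by
  have hemb : Topology.IsClosedEmbedding
      (fun U : QU ι => fun i j => (U : Matrix (Reg ι) (Reg ι) ℂ) i j) := by
    refine ⟨Topology.IsEmbedding.subtypeVal, ?_⟩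
    have h : Set.range (fun U : QU ι => fun i j => (U : Matrix (Reg ι) (Reg ι) ℂ) i j)
        = {A : Matrix (Reg ι) (Reg ι) ℂ | star A * A = 1} ∩ {A | A * star A = 1} := by
      ext A
      constructor
      · rintro ⟨U, rfl⟩
        exact U.2
      · intro hA
        exact ⟨⟨A, hA⟩, rfl⟩
    rw [h]
    exact (isClosed_eq (by fun_prop : Continuous fun A : Matrix (Reg ι) (Reg ι) ℂ => star A * A)
      continuous_const).inter (isClosed_eq
        (by fun_prop : Continuous fun A : Matrix (Reg ι) (Reg ι) ℂ => A * star A)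
        continuous_const)
  refine ⟨?_⟩
  rw [hemb.isInducing.isCompact_iff]
  refine IsCompact.of_isClosed_subset
    (isCompact_univ_pi fun _ : Reg ι => isCompact_univ_pi fun _ : Reg ι =>
      isCompact_closedBall (0 : ℂ) 1) ?_ ?_
  · rw [Set.image_univ]
    exact hemb.isClosed_range
  · rintro _ ⟨U, -, rfl⟩ i - j -
    simpa using entry_norm_bound_of_unitary U.2 i j

instance : MeasurableSpace (QU ι) := borel _

instance : BorelSpace (QU ι) := ⟨rfl⟩

/-- The Haar probability measure on the unitary group. -/
def haarUnitary : Measure (QU ι) := Measure.haarMeasure ⊤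

end Haar

/-! ## Quantum circuits and algorithms -/

/-- The universal gate set `{H, T, CNOT}` acting on wires in `ι`. -/
inductive Gate (ι : Type) : Type
  | h (i : ι) : Gate ι
  | t (i : ι) : Gate ι
  | cnot (control target : ι) (ne : control ≠ target) : Gate ι

def hadamard : Op (Fin 1) :=
  Matrix.of fun x y => if x 0 && y 0 then -((Real.sqrt 2 : ℂ)⁻¹) else (Real.sqrt 2 : ℂ)⁻¹

def tMatrix : Op (Fin 1) :=
  Matrix.diagonal fun x => if x 0 then Complex.exp (Complex.I * Real.pi / 4) else 1

def cnotMatrix : Op (Fin 2) :=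
  Matrix.of fun x y => if x 0 = y 0 ∧ x 1 = xor (y 0) (y 1) then 1 else 0

def Gate.op {ι : Type} [Fintype ι] [DecidableEq ι] : Gate ι → Op ι
  | .h i => onWires (fun _ : Fin 1 => i) hadamard
  | .t i => onWires (fun _ : Fin 1 => i) tMatrix
  | .cnot c d _ => onWires ![c, d] cnotMatrix

/-- An elementary gate, or a query to a unitary oracle on the register `κ`. -/
inductive OracleGate (κ ι : Type) : Type
  | gate (g : Gate ι) : OracleGate κ ι
  | query (w : κ ↪ ι) : OracleGate κ ι

def OracleGate.op {κ ι : Type} [Fintype κ] [DecidableEq κ] [Fintype ι] [DecidableEq ι]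
    (U : QU κ) : OracleGate κ ι → Op ι
  | .gate g => g.op
  | .query w => onWires w (U : Op κ)

/-- The operator of a circuit; the head of the list is applied first. -/
def circuitOp {ι : Type} [Fintype ι] [DecidableEq ι] (l : List (Op ι)) : Op ι :=
  l.foldl (fun M g => g * M) 1

/-- A quantum algorithm with input register `ι` and gates from `G`: it adds `anc` ancillas in state
`|0⟩`, runs a circuit, and measures the wire `out`. -/
structure Algorithm (G : Type → Type) (ι : Type) where
  anc : ℕ
  circuit : List (G (ι ⊕ Fin anc))
  out : ι ⊕ Fin anc

namespace Algorithm

variable {G : Type → Type} {ι : Type}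

/-- Number of ancillas plus number of gates (and queries). -/
def size (A : Algorithm G ι) : ℕ := A.anc + A.circuit.length

/-- The probability that the algorithm outputs `b` on input state `ρ`, where `sem` interprets the
gates. -/
def outputProb [Fintype ι] [DecidableEq ι] (A : Algorithm G ι)
    (sem : G (ι ⊕ Fin A.anc) → Op (ι ⊕ Fin A.anc)) (ρ : Op ι) (b : Bool) : ℝ :=
  let C := circuitOp (A.circuit.map sem)
  ∑ x, if x A.out = b then ((C * withAncillas A.anc ρ * Cᴴ) x x).re else 0

end Algorithm

/-- A keyed family of unitaries is efficiently implementable: there are polynomial-size circuits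
(with ancillas) that take the key `k` and any state `ψ` to a state whose restriction to the data
register has fidelity at least `1 - negl(n)` with `W k ψ`. -/
def EfficientlyImplementable (K Z : ℕ → Type) [∀ n, Fintype (K n)] [∀ n, DecidableEq (K n)]
    [∀ n, Fintype (Z n)] [∀ n, DecidableEq (Z n)] (W : ∀ n, Reg (K n) → QU (Z n)) : Prop :=
  ∃ (anc : ℕ → ℕ) (C : ∀ n, List (Gate (K n ⊕ Z n ⊕ Fin (anc n)))) (ε : ℕ → ℝ),
    PolyBounded anc ∧ PolyBounded (fun n => (C n).length) ∧ Negligible ε ∧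
    ∀ (n : ℕ) (k : Reg (K n)) (ψ : Reg (Z n) → ℂ), ∑ y, ‖ψ y‖ ^ 2 = 1 →
      let input : Reg (K n ⊕ Z n ⊕ Fin (anc n)) → ℂ := fun x =>
        if x ∘ Sum.inl = k ∧ x ∘ Sum.inr ∘ Sum.inr = fun _ => false then
          ψ (x ∘ Sum.inr ∘ Sum.inl)
        else 0
      let output := circuitOp ((C n).map Gate.op) *ᵥ input
      let target := (W n k : Op (Z n)) *ᵥ ψ
      1 - ε n ≤ ∑ k' : Reg (K n), ∑ a : Reg (Fin (anc n)),
        ‖∑ y, star (target y) * output (Sum.elim k' (Sum.elim y a))‖ ^ 2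

/-! ## Pseudorandom unitaries -/

/-- The average over a uniformly random key. -/
def keyAverage {K : Type} [Fintype K] (f : K → ℝ) : ℝ := (∑ k, f k) / Fintype.card K

/-- A family of QPT oracle algorithms, with query access to a unitary on `z n` qubits: the `n`-th
member is a polynomial-size oracle circuit that starts in an arbitrary (advice) state of
polynomially many qubits. -/
structure OracleAdversary (z : ℕ → ℕ) where
  wires : ℕ → ℕ
  advice : ∀ n, Op (Fin (wires n))
  advice_density : ∀ n, IsDensity (advice n)
  alg : ∀ n, Algorithm (OracleGate (Fin (z n))) (Fin (wires n))
  wires_poly : PolyBounded wires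
  alg_poly : PolyBounded fun n => (alg n).size

/-- The probability that the adversary outputs `1` with oracle `U`. -/
def OracleAdversary.accept {z : ℕ → ℕ} (A : OracleAdversary z) (n : ℕ) (U : QU (Fin (z n))) : ℝ :=
  (A.alg n).outputProb (OracleGate.op U) (A.advice n) true

/-- Pseudorandom unitaries on `z n` qubits with keys in `{0,1}^(lam n)`; the security parameter
`lam n` and `n` are polynomially related. -/
structure IsPRU (z lam : ℕ → ℕ) (V : ∀ n, Reg (Fin (lam n)) → QU (Fin (z n))) : Prop where
  lam_poly : PolyBounded lam
  poly_lam : ∃ p : Polynomial ℕ, ∀ n, n ≤ p.eval (lam n)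
  efficient : EfficientlyImplementable (fun n => Fin (lam n)) (fun n => Fin (z n)) V
  pseudorandom : ∀ A : OracleAdversary z,
    NegligibleIn lam fun n =>
      |keyAverage (fun k => A.accept n (V n k)) - ∫ U, A.accept n U ∂haarUnitary (Fin (z n))|

/-! ## Unitary designs -/

/-- `U^{⊗ t}`. -/
def tensorPow {α : Type} (t : ℕ) (U : Matrix α α ℂ) : Matrix (Fin t → α) (Fin t → α) ℂ :=
  Matrix.of fun x y => ∏ s, U (x s) (y s)

/-- The `t`-fold Haar twirl `X ↦ E_U [U^{⊗t} X U^{†⊗t}]`. -/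
def haarTwirl (ι : Type) [Fintype ι] [DecidableEq ι] (t : ℕ)
    (X : Matrix (Fin t → Reg ι) (Fin t → Reg ι) ℂ) :
    Matrix (Fin t → Reg ι) (Fin t → Reg ι) ℂ :=
  Matrix.of fun x y =>
    ∫ U : QU ι, (tensorPow t (U : Op ι) * X * (tensorPow t (U : Op ι))ᴴ) x y ∂haarUnitary ι

/-- The `t`-fold twirl over a uniformly random element of a finite keyed ensemble. -/
def ensembleTwirl {ι K : Type} [Fintype ι] [DecidableEq ι] [Fintype K] (V : K → QU ι) (t : ℕ)
    (X : Matrix (Fin t → Reg ι) (Fin t → Reg ι) ℂ) :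
    Matrix (Fin t → Reg ι) (Fin t → Reg ι) ℂ :=
  (Fintype.card K : ℂ)⁻¹ • ∑ k, tensorPow t (V k : Op ι) * X * (tensorPow t (V k : Op ι))ᴴ

/-- Complete positivity: `Ψ ⊗ id` preserves positive semidefiniteness for every finite-dimensional
reference system. -/
def IsCompletelyPositive {α : Type} [Fintype α] (Ψ : Matrix α α ℂ → Matrix α α ℂ) : Prop :=
  ∀ (r : ℕ) (X : Matrix (α × Fin r) (α × Fin r) ℂ), X.PosSemidef →
    (Matrix.of fun p q : α × Fin r =>
      Ψ (Matrix.of fun i j => X (i, p.2) (j, q.2)) p.1 q.1).PosSemidef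

/-- Approximate unitary `t`-design with relative error `ε` (exact for `ε = 0`). -/
def IsApproxDesign {ι K : Type} [Fintype ι] [DecidableEq ι] [Fintype K] (V : K → QU ι) (t : ℕ)
    (ε : ℝ) : Prop :=
  IsCompletelyPositive (fun X => ensembleTwirl V t X - ((1 - ε : ℝ) : ℂ) • haarTwirl ι t X) ∧
  IsCompletelyPositive (fun X => ((1 + ε : ℝ) : ℂ) • haarTwirl ι t X - ensembleTwirl V t X)

/-! ## The pseudorandom quantum authentication scheme -/

/-- A pseudorandom quantum authentication scheme for `n`-qubit states: `tag n` tag qubits, `mix n`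
maximally mixed qubits, and keys `(k₁, k₂, k₃)` of `len₁ n + len₂ n + len₃ n` bits. -/
structure PQAS where
  tag : ℕ → ℕ
  mix : ℕ → ℕ
  len₁ : ℕ → ℕ
  len₂ : ℕ → ℕ
  len₃ : ℕ → ℕ
  V₁ : ∀ n, Reg (Fin (len₁ n)) → QU (Fin (n + tag n + mix n))
  V₂ : ∀ n, Reg (Fin (len₂ n)) → QU (Fin (n + tag n + mix n))
  V₃ : ∀ n, Reg (Fin (len₃ n)) → QU (Fin (n + tag n + mix n))
  tag_poly : PolyBounded tag
  mix_poly : PolyBounded mix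
  tag_superlog : SuperLogarithmic tag
  mix_superlog : SuperLogarithmic mix
  key_poly : PolyBounded fun n => len₁ n + len₂ n + len₃ n
  pru : IsPRU (fun n => n + tag n + mix n) len₁ V₁
  four_design : ∃ p : ℕ → ℝ, PolyLog p ∧
    ∀ n, IsApproxDesign (V₂ n) 4 ((2 : ℝ) ^ (-(2 * (mix n : ℝ)) - p n))
  two_design : ∀ n, IsApproxDesign (V₃ n) 2 0
  efficient : EfficientlyImplementable
    (fun n => Fin (len₁ n) ⊕ Fin (len₂ n) ⊕ Fin (len₃ n)) (fun n => Fin (n + tag n + mix n))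
    (fun n k => V₁ n (k ∘ Sum.inl) * V₂ n (k ∘ Sum.inr ∘ Sum.inl) * V₃ n (k ∘ Sum.inr ∘ Sum.inr))

/-- Concatenation of the basis labels of three consecutive registers. -/
def joinRegs (a b c : ℕ) :
    (Reg (Fin a) × Reg (Fin b)) × Reg (Fin c) ≃ Reg (Fin (a + b + c)) :=
  ((Fin.appendEquiv a b).prodCongr (Equiv.refl _)).trans (Fin.appendEquiv (a + b) c)

/-- `|0…0⟩⟨0…0|`. -/
def zeroState (ι : Type) [Fintype ι] [DecidableEq ι] : Op ι :=
  Matrix.single (fun _ => false) (fun _ => false) 1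

/-- `I / 2^|ι|`. -/
def maxMixed (ι : Type) [Fintype ι] [DecidableEq ι] : Op ι :=
  ((2 : ℂ) ^ Fintype.card ι)⁻¹ • 1

/-- The channel `ρ ↦ U (ρ ⊗ |0_ℓ⟩⟨0_ℓ| ⊗ σ_m) U†`. -/
def padAndScramble (n l m : ℕ) (U : QU (Fin (n + l + m))) :
    Op (Fin n) →ₗ[ℂ] Op (Fin (n + l + m)) where
  toFun ρ :=
    (U : Op (Fin (n + l + m))) *
      Matrix.reindex (joinRegs n l m) (joinRegs n l m)
        ((ρ ⊗ₖ zeroState (Fin l)) ⊗ₖ maxMixed (Fin m)) *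
      (U : Op (Fin (n + l + m)))ᴴ
  map_add' ρ τ := by
    simp only [Matrix.add_kronecker, Matrix.reindex_apply, Matrix.submatrix_add, Pi.add_apply,
      Matrix.mul_add, Matrix.add_mul]
  map_smul' c ρ := by
    simp only [Matrix.smul_kronecker, Matrix.reindex_apply, Matrix.submatrix_smul, Pi.smul_apply,
      Matrix.mul_smul, Matrix.smul_mul, RingHom.id_apply]

theorem padAndScramble_apply (n l m : ℕ) (U : QU (Fin (n + l + m))) (ρ : Op (Fin n)) :
    padAndScramble n l m U ρ =
      (U : Op (Fin (n + l + m))) *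
        Matrix.reindex (joinRegs n l m) (joinRegs n l m)
          ((ρ ⊗ₖ zeroState (Fin l)) ⊗ₖ maxMixed (Fin m)) *
        (U : Op (Fin (n + l + m)))ᴴ := rfl

namespace PQAS

/-- Number of qubits of a ciphertext. -/
def z (P : PQAS) (n : ℕ) : ℕ := n + P.tag n + P.mix n

/-- The security parameter: the total length of the key. -/
def lam (P : PQAS) (n : ℕ) : ℕ := P.len₁ n + P.len₂ n + P.len₃ n

/-- The key space `{0,1}^λ`, a key being `k = (k₁, k₂, k₃)`. -/
abbrev Key (P : PQAS) (n : ℕ) : Type :=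
  Reg (Fin (P.len₁ n)) × Reg (Fin (P.len₂ n)) × Reg (Fin (P.len₃ n))

/-- `U_k = V₁(k₁) V₂(k₂) V₃(k₃)`. -/
def unitary (P : PQAS) (n : ℕ) (k : P.Key n) : QU (Fin (P.z n)) :=
  P.V₁ n k.1 * P.V₂ n k.2.1 * P.V₃ n k.2.2

/-- The encryption channel `Φ_k`. -/
def encrypt (P : PQAS) (n : ℕ) (k : P.Key n) : Op (Fin n) →ₗ[ℂ] Op (Fin (P.z n)) :=
  padAndScramble n (P.tag n) (P.mix n) (P.unitary n k)

end PQAS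

/-! ## The left-or-right oracle experiment -/

section Channels

variable {α β γ : Type}

/-- `Φ ⊗ id`. -/
def ampliateRight (γ : Type) (Φ : Matrix α α ℂ →ₗ[ℂ] Matrix β β ℂ) :
    Matrix (α × γ) (α × γ) ℂ →ₗ[ℂ] Matrix (β × γ) (β × γ) ℂ where
  toFun X := Matrix.of fun p q => Φ (Matrix.of fun i j => X (i, p.2) (j, q.2)) p.1 q.1
  map_add' X Y := by
    ext p q
    exact congrFun (congrFun (map_add Φ (Matrix.of fun i j => X (i, p.2) (j, q.2))
      (Matrix.of fun i j => Y (i, p.2) (j, q.2))) p.1) q.1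
  map_smul' c X := by
    ext p q
    exact congrFun (congrFun (map_smul Φ c (Matrix.of fun i j => X (i, p.2) (j, q.2))) p.1) q.1

/-- `id ⊗ Φ`. -/
def ampliateLeft (γ : Type) (Φ : Matrix α α ℂ →ₗ[ℂ] Matrix β β ℂ) :
    Matrix (γ × α) (γ × α) ℂ →ₗ[ℂ] Matrix (γ × β) (γ × β) ℂ where
  toFun X := Matrix.of fun p q => Φ (Matrix.of fun i j => X (p.1, i) (q.1, j)) p.2 q.2
  map_add' X Y := by
    ext p q
    exact congrFun (congrFun (map_add Φ (Matrix.of fun i j => X (p.1, i) (q.1, j))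
      (Matrix.of fun i j => Y (p.1, i) (q.1, j))) p.2) q.2
  map_smul' c X := by
    ext p q
    exact congrFun (congrFun (map_smul Φ c (Matrix.of fun i j => X (p.1, i) (q.1, j))) p.2) q.2

/-- Partial trace over the second factor. -/
def traceSnd [Fintype γ] : Matrix (α × γ) (α × γ) ℂ →ₗ[ℂ] Matrix α α ℂ where
  toFun X := Matrix.of fun i j => ∑ c, X (i, c) (j, c)
  map_add' X Y := by ext i j; simp [Finset.sum_add_distrib]
  map_smul' c X := by ext i j; simp [Finset.mul_sum]

/-- Partial trace over the first factor. -/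
def traceFst [Fintype γ] : Matrix (γ × α) (γ × α) ℂ →ₗ[ℂ] Matrix α α ℂ where
  toFun X := Matrix.of fun i j => ∑ c, X (c, i) (c, j)
  map_add' X Y := by ext i j; simp [Finset.sum_add_distrib]
  map_smul' c X := by ext i j; simp [Finset.mul_sum]

/-- The left-or-right oracle: encrypt the left input (`b = 0`) or the right input (`b = 1`), and
trace out the other one. -/
def leftRight [Fintype α] (Φ : Matrix α α ℂ →ₗ[ℂ] Matrix β β ℂ) (b : Bool) :
    Matrix (α × α) (α × α) ℂ →ₗ[ℂ] Matrix β β ℂ :=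
  if b then traceFst ∘ₗ ampliateLeft α Φ else traceSnd ∘ₗ ampliateRight α Φ

/-- `Φ^{⊗t} ⊗ id_γ`, by linear extension from matrix units. -/
def parallel [Fintype α] [DecidableEq α] (t : ℕ) (Φ : Matrix α α ℂ →ₗ[ℂ] Matrix β β ℂ)
    (X : Matrix ((Fin t → α) × γ) ((Fin t → α) × γ) ℂ) :
    Matrix ((Fin t → β) × γ) ((Fin t → β) × γ) ℂ :=
  Matrix.of fun p q => ∑ i : Fin t → α, ∑ j : Fin t → α,
    X (i, p.2) (j, q.2) * ∏ s, Φ (Matrix.single (i s) (j s) 1) (p.1 s) (q.1 s)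

end Channels

/-- A state of `t` registers of `z` qubits and a reference of `r` qubits, as a state of one
register. -/
def flatten {t z r : ℕ}
    (X : Matrix ((Fin t → Reg (Fin z)) × Reg (Fin r)) ((Fin t → Reg (Fin z)) × Reg (Fin r)) ℂ) :
    Op ((Fin t × Fin z) ⊕ Fin r) :=
  X.submatrix (fun x => (fun s i => x (Sum.inl (s, i)), fun j => x (Sum.inr j)))
    (fun x => (fun s i => x (Sum.inl (s, i)), fun j => x (Sum.inr j)))

/-- A QPT adversary in the left-or-right experiment with `t n` non-adaptive queries. It holds an
arbitrary state of `t n` pairs (left input, right input) of `n`-qubit registers and of `r n` further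
qubits, which are not sent to the oracle. All of these may be entangled. After the queries, it runs
a polynomial-size circuit on the `t n` ciphertexts and its `r n` qubits. -/
structure CPAAdversary (P : PQAS) where
  t : ℕ → ℕ
  r : ℕ → ℕ
  state : ∀ n, Matrix ((Fin (t n) → Reg (Fin n) × Reg (Fin n)) × Reg (Fin (r n)))
    ((Fin (t n) → Reg (Fin n) × Reg (Fin n)) × Reg (Fin (r n))) ℂ
  state_density : ∀ n, IsDensity (state n)
  alg : ∀ n, Algorithm Gate ((Fin (t n) × Fin (P.z n)) ⊕ Fin (r n))
  t_poly : PolyBounded t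
  r_poly : PolyBounded r
  alg_poly : PolyBounded fun n => (alg n).size

namespace CPAAdversary

variable {P : PQAS}

/-- The probability, over a uniformly random key and the measurement, that the adversary outputs
`b'` when the oracle is the left-or-right oracle with bit `b`. -/
def outputProb (A : CPAAdversary P) (n : ℕ) (b b' : Bool) : ℝ :=
  keyAverage fun k : P.Key n =>
    (A.alg n).outputProb Gate.op
      (flatten (parallel (A.t n) (leftRight (P.encrypt n k) b) (A.state n))) b'

/-- The distinguishing advantage `|Pr[A = 1 | b = 0] - Pr[A = 1 | b = 1]|`. -/
def advantage (A : CPAAdversary P) (n : ℕ) : ℝ :=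
  |A.outputProb n false true - A.outputProb n true true|

/-- The probability that the adversary guesses a uniformly random bit `b`. -/
def successProb (A : CPAAdversary P) (n : ℕ) : ℝ :=
  (∑ b : Bool, A.outputProb n b b) / 2

end CPAAdversary

end QCrypto

end

noncomputable section

namespace QCrypto

set_option linter.unusedSectionVars false

/-! ## Negligible functions -/

/-! Replace `V₁` by a Haar unitary, and show that a Haar-random encryption hides its input from a
non-adaptive adversary.

Haar world. The maximally mixed qubits are a uniform mixture of basis strings, so `t` queries use
independent strings `σ 1, …, σ t`. They collide with probability at most `t² / 2^m`
(`card_not_injective_mul_le`). If they are distinct, the inputs `i` and `j` select columns of `U`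
that are distinct across queries. The moment belonging to `|i⟩⟨j|` vanishes for `i ≠ j`, by a sign
flip of one column, and is independent of `i` for `i = j`, by a permutation of columns. Hence the
averaged ciphertext depends on the input only through the marginal on the reference
(`integral_scramble_apply`). Tracing out all `2t` inputs gives this marginal for both values of the
bit (`sum_selectInput`), so the Haar advantage is at most `t² / 2^m`, which decays fast because `m =
ω(log n)`.

Reduction. An adversary against `V₁` holds as advice the inputs already scrambled by `V₂ V₃` with
random keys; one query per register completes the encryption (`outputProb_relabel_afterQueries`).
With a Haar oracle, right invariance absorbs `V₂ V₃`. The advantage is thus at most two PRU errors,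
one for each value of the bit, plus the Haar term.

Asymptotics are carried in `n` through `DecaysFast` and converted to the key length only at the end.
-/

theorem monotone_eval (p : Polynomial ℕ) : Monotone fun n => p.eval n := by
  intro a b h
  simp only [Polynomial.eval_eq_sum_range]
  gcongr

theorem exists_eval_le_pow (p : Polynomial ℕ) : ∃ d : ℕ, ∀ n, 2 ≤ n → p.eval n ≤ n ^ d := by
  -- `p.eval 1` is the sum of the coefficients, and `p.eval 1 < n ^ p.eval 1` for `n ≥ 2`.
  refine ⟨p.eval 1 + p.natDegree, fun n hn => ?_⟩
  have h1 : p.eval n ≤ p.eval 1 * n ^ p.natDegree := by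
    rw [Polynomial.eval_eq_sum_range, Polynomial.eval_eq_sum_range, Finset.sum_mul]
    refine Finset.sum_le_sum fun i hi => ?_
    rw [one_pow, mul_one]
    exact Nat.mul_le_mul_left _ (Nat.pow_le_pow_right (by omega)
      (Nat.lt_succ_iff.1 (Finset.mem_range.1 hi)))
  rw [pow_add]
  exact h1.trans (Nat.mul_le_mul_right _ ((Nat.lt_pow_self (by omega)).le))

theorem PolyBounded.exists_le_pow {f : ℕ → ℕ} (hf : PolyBounded f) :
    ∃ d : ℕ, ∀ n, 2 ≤ n → f n ≤ n ^ d := by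
  obtain ⟨p, hp⟩ := hf
  obtain ⟨d, hd⟩ := exists_eval_le_pow p
  exact ⟨d, fun n hn => (hp n).trans (hd n hn)⟩

theorem PolyBounded.mono {f g : ℕ → ℕ} (hg : PolyBounded g) (h : ∀ n, f n ≤ g n) :
    PolyBounded f := by
  obtain ⟨p, hp⟩ := hg
  exact ⟨p, fun n => (h n).trans (hp n)⟩

theorem PolyBounded.add {f g : ℕ → ℕ} (hf : PolyBounded f) (hg : PolyBounded g) :
    PolyBounded fun n => f n + g n := by
  obtain ⟨p, hp⟩ := hf
  obtain ⟨q, hq⟩ := hg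
  exact ⟨p + q, fun n => by rw [Polynomial.eval_add]; exact add_le_add (hp n) (hq n)⟩

theorem PolyBounded.mul {f g : ℕ → ℕ} (hf : PolyBounded f) (hg : PolyBounded g) :
    PolyBounded fun n => f n * g n := by
  obtain ⟨p, hp⟩ := hf
  obtain ⟨q, hq⟩ := hg
  exact ⟨p * q, fun n => by rw [Polynomial.eval_mul]; exact Nat.mul_le_mul (hp n) (hq n)⟩

theorem PolyBounded.id : PolyBounded fun n => n :=
  ⟨Polynomial.X, fun n => by rw [Polynomial.eval_X]⟩

/-- `f` is eventually at most every inverse polynomial. -/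
def DecaysFast (f : ℕ → ℝ) : Prop :=
  ∀ c : ℕ, ∀ᶠ n : ℕ in atTop, f n ≤ ((n : ℝ) ^ c)⁻¹

theorem DecaysFast.mono {f g : ℕ → ℝ} (hg : DecaysFast g) (h : ∀ n, f n ≤ g n) : DecaysFast f :=
  fun c => (hg c).mono fun n hn => (h n).trans hn

theorem DecaysFast.add {f g : ℕ → ℝ} (hf : DecaysFast f) (hg : DecaysFast g) :
    DecaysFast fun n => f n + g n := by
  intro c
  -- The spare factor `n⁻¹ ≤ 1/2` absorbs the sum of two terms.
  filter_upwards [hf (c + 1), hg (c + 1), eventually_ge_atTop 2] with n h1 h2 hn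
  have hn' : (2 : ℝ) ≤ n := by exact_mod_cast hn
  have hpos : (0 : ℝ) < (n : ℝ) ^ c := by positivity
  have key : ((n : ℝ) ^ (c + 1))⁻¹ + ((n : ℝ) ^ (c + 1))⁻¹ ≤ ((n : ℝ) ^ c)⁻¹ := by
    rw [pow_succ, mul_inv, ← mul_add]
    refine mul_le_of_le_one_right (inv_nonneg.2 hpos.le) ?_
    have : (n : ℝ)⁻¹ ≤ 2⁻¹ := inv_anti₀ (by norm_num) hn'
    linarith
  linarith

/-- A negligible function of `s n` decays fast in `n` if `n` is polynomially bounded in `s n`. -/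
theorem NegligibleIn.decaysFast {s : ℕ → ℕ} {f : ℕ → ℝ} (h : NegligibleIn s f)
    (hs : ∃ p : Polynomial ℕ, ∀ n, n ≤ p.eval (s n)) : DecaysFast f := by
  obtain ⟨μ, ⟨-, hμ⟩, hf⟩ := h
  obtain ⟨p, hp⟩ := hs
  obtain ⟨d, hd⟩ := exists_eval_le_pow p
  intro c
  -- From `n ≤ (s n) ^ d` follows `n ^ c ≤ (s n) ^ (d * c)`.
  obtain ⟨l₀, hl₀⟩ := hμ (d * c)
  -- `s n` tends to infinity: `s n ≤ l₀ + 2` would bound `n ≤ p.eval (s n)` by the sum of the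
  -- finitely many values of `p` there.
  have hbig : ∀ᶠ n in atTop, l₀ + 2 < s n := by
    refine (eventually_gt_atTop (∑ l ∈ Finset.range (l₀ + 3), p.eval l)).mono fun n hn => ?_
    by_contra hcon
    have : p.eval (s n) ≤ ∑ l ∈ Finset.range (l₀ + 3), p.eval l :=
      Finset.single_le_sum (f := fun l => p.eval l) (fun _ _ => Nat.zero_le _)
        (Finset.mem_range.2 (by omega))
    exact absurd (hp n) (by omega)
  filter_upwards [hbig, eventually_gt_atTop 0] with n hn hn0
  refine (hf n).trans ((hl₀ (s n) (by omega)).le.trans ?_)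
  have h1 : n ≤ s n ^ d := (hp n).trans (hd _ (by omega))
  refine inv_anti₀ (by positivity) ?_
  rw [pow_mul]
  exact_mod_cast Nat.pow_le_pow_left h1 c

/-- A fast decaying function of `n` is negligible in `s n` if `n` and `s n` are polynomially
related. -/
theorem DecaysFast.negligibleIn {s : ℕ → ℕ} {f : ℕ → ℝ} (hf : DecaysFast f) (hf0 : ∀ n, 0 ≤ f n)
    (hs : PolyBounded s) (hs' : ∃ p : Polynomial ℕ, ∀ n, n ≤ p.eval (s n)) :
    NegligibleIn s f := by
  obtain ⟨p, hp⟩ := hs'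
  obtain ⟨d, hd⟩ := hs.exists_le_pow
  -- The whole fibre of `s` over `l`: the cutoff loses nothing because `n ≤ p.eval (s n)`. The bound
  -- at `l` is the supremum of `f` over this fibre, `0` if it is empty; the term `2⁻¹ ^ l` makes it
  -- strictly positive.
  let S : ℕ → Finset ℕ := fun l => (Finset.range (p.eval l + 1)).filter fun n => s n = l
  let μ : ℕ → NNReal := fun l => (S l).sup fun n => (f n).toNNReal
  refine ⟨fun l => (μ l : ℝ) + 2⁻¹ ^ l, ⟨fun l => by positivity, fun c => ?_⟩, fun n => ?_⟩
  · have h2 : ∀ᶠ l : ℕ in atTop, (l : ℝ) ^ (c + 1) * 2⁻¹ ^ l < 1 :=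
      (tendsto_pow_const_mul_const_pow_of_abs_lt_one (c + 1)
        (by rw [abs_of_pos] <;> norm_num : |(2⁻¹ : ℝ)| < 1)).eventually_lt_const one_pos
    obtain ⟨n₀, hn₀⟩ := eventually_atTop.1 (hf (d * (c + 1)))
    -- Once `l` exceeds all `s n` with `n < n₀ + 2`, the fibre over `l` contains only large `n`, and
    -- there `l = s n ≤ n ^ d`.
    have h1 : ∀ᶠ l : ℕ in atTop, (μ l : ℝ) ≤ ((l : ℝ) ^ (c + 1))⁻¹ := by
      refine (eventually_gt_atTop (∑ n ∈ Finset.range (n₀ + 2), s n)).mono fun l hl => ?_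
      have hl0 : (0 : ℝ) < l := by exact_mod_cast (Nat.zero_le _).trans_lt hl
      rw [← Real.coe_toNNReal ((l : ℝ) ^ (c + 1))⁻¹ (by positivity), NNReal.coe_le_coe]
      refine Finset.sup_le fun n hn => Real.toNNReal_le_toNNReal ?_
      have hsn : s n = l := (Finset.mem_filter.1 hn).2
      have hn1 : n₀ + 2 ≤ n := by
        by_contra hcon
        have : s n ≤ ∑ n ∈ Finset.range (n₀ + 2), s n :=
          Finset.single_le_sum (f := s) (fun _ _ => Nat.zero_le _)
            (Finset.mem_range.2 (by omega))
        omega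
      refine (hn₀ n (by omega)).trans (inv_anti₀ (by positivity) ?_)
      rw [pow_mul, ← hsn]
      exact_mod_cast Nat.pow_le_pow_left (hd n (by omega)) (c + 1)
    obtain ⟨l₀, hl₀⟩ := eventually_atTop.1 ((h1.and h2).and (eventually_gt_atTop 2))
    refine ⟨l₀, fun l hl => ?_⟩
    obtain ⟨⟨h3, h4⟩, h5⟩ := hl₀ l hl.le
    have h5' : (2 : ℝ) < l := by exact_mod_cast h5
    have h6 : (2⁻¹ : ℝ) ^ l < ((l : ℝ) ^ (c + 1))⁻¹ := by
      rw [← mul_one ((l : ℝ) ^ (c + 1))⁻¹, lt_inv_mul_iff₀ (by positivity)]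
      exact h4
    have h7 : ((l : ℝ) ^ (c + 1))⁻¹ + ((l : ℝ) ^ (c + 1))⁻¹ ≤ ((l : ℝ) ^ c)⁻¹ := by
      rw [pow_succ, mul_inv, ← mul_add]
      refine mul_le_of_le_one_right (by positivity) ?_
      have : (l : ℝ)⁻¹ ≤ 2⁻¹ := inv_anti₀ (by norm_num) h5'.le
      linarith
    linarith
  · have hmem : n ∈ S (s n) :=
      Finset.mem_filter.2 ⟨Finset.mem_range.2 (Nat.lt_succ_of_le (hp n)), rfl⟩
    have h1 : (f n).toNNReal ≤ μ (s n) :=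
      Finset.le_sup (f := fun n => (f n).toNNReal) hmem
    have h2 : f n ≤ (μ (s n) : ℝ) := by
      rw [← Real.coe_toNNReal (f n) (hf0 n)]
      exact_mod_cast h1
    exact h2.trans (le_add_of_nonneg_right (by positivity))

theorem SuperLogarithmic.decaysFast {t m : ℕ → ℕ} (hm : SuperLogarithmic m) (ht : PolyBounded t) :
    DecaysFast fun n => (t n : ℝ) * (2 ^ m n)⁻¹ := by
  obtain ⟨d, hd⟩ := ht.exists_le_pow
  intro c
  have hlog2 : 0 < Real.log 2 := Real.log_pos (by norm_num)
  -- Chosen so that `(d + c) log n ≤ m n * log 2`; the `+ 1` keeps the denominator positive.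
  have h := hm.def (c := Real.log 2 / (d + c + 1)) (by positivity)
  filter_upwards [h, eventually_ge_atTop 2] with n hn hn2
  have hn0 : (0 : ℝ) < n := by exact_mod_cast (by omega : 0 < n)
  have h1 : (n : ℝ) ^ (d + c) ≤ 2 ^ m n := by
    rw [← Real.log_le_log_iff (by positivity) (by positivity), Real.log_pow, Real.log_pow]
    rw [Real.norm_of_nonneg (Real.log_natCast_nonneg n), Real.norm_of_nonneg (by positivity),
      div_mul_eq_mul_div, le_div_iff₀ (by positivity)] at hn
    have h3 := Real.log_natCast_nonneg n
    push_cast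
    nlinarith
  have h2 : (t n : ℝ) ≤ (n : ℝ) ^ d := by exact_mod_cast hd n hn2
  rw [← div_eq_mul_inv, div_le_iff₀ (by positivity), inv_mul_eq_div, le_div_iff₀ (by positivity)]
  calc (t n : ℝ) * n ^ c ≤ n ^ d * n ^ c := by gcongr
    _ = n ^ (d + c) := (pow_add _ _ _).symm
    _ ≤ _ := h1

/-! ## Haar moments -/

section HaarMoments

variable {ι : Type} [Fintype ι] [DecidableEq ι]

instance : (haarUnitary ι).IsHaarMeasure := by
  unfold haarUnitary
  infer_instance

instance : IsProbabilityMeasure (haarUnitary ι) :=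
  ⟨by simpa [haarUnitary] using
    Measure.haarMeasure_self (K₀ := (⊤ : TopologicalSpace.PositiveCompacts (QU ι)))⟩

/-- Compact groups are unimodular: a right translate of Haar measure is again a Haar probability
measure, and there is only one. -/
instance : (haarUnitary ι).IsMulRightInvariant :=
  ⟨fun g => by
    have : IsProbabilityMeasure ((haarUnitary ι).map (· * g)) :=
      Measure.isProbabilityMeasure_map (measurable_mul_const g).aemeasurable
    have : ((haarUnitary ι).map (· * g)).IsHaarMeasure := inferInstance
    exact Measure.isHaarMeasure_eq_of_isProbabilityMeasure _ _⟩

theorem continuous_unitary_entry (i j : Reg ι) : Continuous fun U : QU ι => (U : Op ι) i j :=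
  (continuous_apply j).comp ((continuous_apply i).comp continuous_subtype_val)

theorem _root_.Continuous.integrable_haarUnitary {E : Type*} [NormedAddCommGroup E]
    [SecondCountableTopologyEither (QU ι) E] {f : QU ι → E} (hf : Continuous f) :
    Integrable f (haarUnitary ι) :=
  hf.integrable_of_hasCompactSupport (HasCompactSupport.of_compactSpace f)

variable {t : ℕ}

/-- A monomial in the entries of `U` and their conjugates. -/
def entryMonomial (p q a b : Fin t → Reg ι) (U : Op ι) : ℂ :=
  ∏ s, (U (p s) (a s) * star (U (q s) (b s)))

theorem continuous_entryMonomial (p q a b : Fin t → Reg ι) :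
    Continuous fun U : QU ι => entryMonomial p q a b (U : Op ι) :=
  continuous_finsetProd _ fun _ _ =>
    (continuous_unitary_entry _ _).mul (continuous_unitary_entry _ _).star

/-- Flipping the sign of the column `a s₀` flips the sign of the monomial. -/
theorem integral_entryMonomial_eq_zero (p q a b : Fin t → Reg ι) (ha : Function.Injective a)
    (hab : ∀ s s', a s = b s' → s = s') (hne : a ≠ b) :
    ∫ U : QU ι, entryMonomial p q a b (U : Op ι) ∂haarUnitary ι = 0 := by
  obtain ⟨s₀, hs₀⟩ := Function.ne_iff.1 hne
  let d : Reg ι → ℂ := fun x => if x = a s₀ then -1 else 1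
  have hd : Matrix.diagonal d ∈ Matrix.unitaryGroup (Reg ι) ℂ := by
    rw [Matrix.mem_unitaryGroup_iff, Matrix.star_eq_conjTranspose, Matrix.diagonal_conjTranspose,
      Matrix.diagonal_mul_diagonal, ← Matrix.diagonal_one]
    congr 1
    ext x
    simp only [d, Pi.star_apply]
    split_ifs <;> simp
  have h : ∀ U : QU ι, entryMonomial p q a b ((U * ⟨Matrix.diagonal d, hd⟩ : QU ι) : Op ι)
      = - entryMonomial p q a b (U : Op ι) := by
    intro U
    -- The column `a s₀` is absent from `b` and, by injectivity, occurs exactly once in `a`, so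
    -- exactly one factor changes sign.
    have hb : ∀ s, b s ≠ a s₀ := fun s h => hs₀ (by
      obtain rfl := hab _ _ h.symm
      exact h.symm)
    have h1 : ∀ s, ((U * ⟨Matrix.diagonal d, hd⟩ : QU ι) : Op ι) (p s) (a s)
        * star (((U * ⟨Matrix.diagonal d, hd⟩ : QU ι) : Op ι) (q s) (b s))
        = (if s = s₀ then -1 else 1) *
          ((U : Op ι) (p s) (a s) * star ((U : Op ι) (q s) (b s))) := by
      intro s
      rw [Submonoid.coe_mul, Matrix.mul_diagonal, Matrix.mul_diagonal]
      simp only [d, if_neg (hb s), mul_one, ha.eq_iff]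
      ring
    rw [entryMonomial, Finset.prod_congr rfl fun s _ => h1 s, Finset.prod_mul_distrib,
      Finset.prod_ite_eq' Finset.univ s₀, if_pos (Finset.mem_univ _), neg_one_mul]
    rfl
  have h2 := integral_mul_right_eq_self (μ := haarUnitary ι)
    (fun U : QU ι => entryMonomial p q a b (U : Op ι)) ⟨Matrix.diagonal d, hd⟩
  simp only [h, integral_neg] at h2
  linear_combination -h2 / 2

/-- Some permutation of the basis carries `a` to `a'`; it acts on columns as right multiplication by
a permutation matrix, which preserves Haar measure. -/
theorem integral_entryMonomial_diag (p q a a' : Fin t → Reg ι) (ha : Function.Injective a)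
    (ha' : Function.Injective a') :
    ∫ U : QU ι, entryMonomial p q a a (U : Op ι) ∂haarUnitary ι
      = ∫ U : QU ι, entryMonomial p q a' a' (U : Op ι) ∂haarUnitary ι := by
  obtain ⟨σ, hσ⟩ := Equiv.Perm.exists_extending_pair a a' ha ha'
  have hS : (1 : Op ι).submatrix σ.symm id ∈ Matrix.unitaryGroup (Reg ι) ℂ := by
    rw [Matrix.mem_unitaryGroup_iff, Matrix.star_eq_conjTranspose, Matrix.conjTranspose_submatrix,
      Matrix.conjTranspose_one]
    rw [← Equiv.coe_refl, Matrix.submatrix_mul_equiv, one_mul, Matrix.submatrix_one_equiv]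
  have h : ∀ U : QU ι, entryMonomial p q a a
      ((U * ⟨(1 : Op ι).submatrix σ.symm id, hS⟩ : QU ι) : Op ι)
      = entryMonomial p q a' a' (U : Op ι) := by
    intro U
    have h1 : ∀ x y, ((U * ⟨(1 : Op ι).submatrix σ.symm id, hS⟩ : QU ι) : Op ι) x y
        = (U : Op ι) x (σ y) := by
      intro x y
      simp [Submonoid.coe_mul, Matrix.mul_apply, Matrix.one_apply, Equiv.symm_apply_eq]
    simp only [entryMonomial, h1, hσ]
  rw [← integral_mul_right_eq_self _ (⟨(1 : Op ι).submatrix σ.symm id, hS⟩ : QU ι)]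
  simp only [h]

end HaarMoments

/-! ## Operators acting on selected wires -/

section OnWires

variable {κ ι : Type} [Fintype κ] [DecidableEq κ] [Fintype ι] [DecidableEq ι]

theorem extend_comp_self {w : κ → ι} (hw : Function.Injective w) (v : Reg κ) (x : Reg ι) :
    Function.extend w v x ∘ w = v :=
  funext fun j => hw.extend_apply v x j

/-- Only basis states that agree with `x` off the wires `w` contribute, and they are parametrised by
their values `v` on `w`. -/
theorem onWires_mul_apply {w : κ → ι} (hw : Function.Injective w) (M : Op κ) {α : Type}
    (N : Matrix (Reg ι) α ℂ) (x : Reg ι) (y : α) :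
    (onWires w M * N) x y = ∑ v, M (x ∘ w) v * N (Function.extend w v x) y := by
  rw [Matrix.mul_apply]
  simp only [onWires, Matrix.of_apply, ite_mul, zero_mul]
  rw [← Finset.sum_filter]
  refine Finset.sum_bij' (fun u _ => u ∘ w) (fun v _ => Function.extend w v x)
    (fun _ _ => Finset.mem_univ _) (fun v _ => ?_) (fun u hu => ?_) (fun v _ => ?_)
    (fun u hu => ?_)
  · rw [Finset.mem_filter]
    refine ⟨Finset.mem_univ _, fun i hi => ?_⟩
    rw [Function.extend_apply' _ _ _ (by simpa using hi)]
  · rw [Finset.mem_filter] at hu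
    ext i
    by_cases h : ∃ j, w j = i
    · obtain ⟨j, rfl⟩ := h
      rw [hw.extend_apply, Function.comp_apply]
    · rw [Function.extend_apply' _ _ _ h]
      exact hu.2 i (by simpa using h)
  · exact extend_comp_self hw _ _
  · rw [Finset.mem_filter] at hu
    congr 2
    ext i
    by_cases h : ∃ j, w j = i
    · obtain ⟨j, rfl⟩ := h
      rw [hw.extend_apply, Function.comp_apply]
    · rw [Function.extend_apply' _ _ _ h]
      exact (hu.2 i (by simpa using h)).symm

theorem onWires_mul {w : κ → ι} (hw : Function.Injective w) (M N : Op κ) :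
    onWires w M * onWires w N = onWires w (M * N) := by
  ext x y
  rw [onWires_mul_apply hw]
  have h : ∀ v : Reg κ, (∀ i, (∀ j, w j ≠ i) → Function.extend w v x i = y i) ↔
      ∀ i, (∀ j, w j ≠ i) → x i = y i := by
    intro v
    refine forall_congr' fun i => imp_congr_right fun hi => ?_
    rw [Function.extend_apply' _ _ _ (by simpa using hi)]
  simp only [onWires, Matrix.of_apply, h, extend_comp_self hw, Matrix.mul_apply]
  split_ifs <;> simp

theorem conjTranspose_onWires (w : κ → ι) (M : Op κ) : (onWires w M)ᴴ = onWires w Mᴴ := by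
  ext x y
  simp only [onWires, Matrix.of_apply, Matrix.conjTranspose_apply, eq_comm (a := y _)]
  split_ifs <;> simp

theorem onWires_one (w : κ → ι) : onWires w (1 : Op κ) = 1 := by
  ext x y
  simp only [onWires, Matrix.of_apply, Matrix.one_apply]
  by_cases h : x = y
  · simp [h]
  · rw [if_neg h]
    split_ifs with h1 h2
    · refine absurd (funext fun i => ?_) h
      by_cases hi : ∃ j, w j = i
      · obtain ⟨j, rfl⟩ := hi
        exact congrFun h2 j
      · exact h1 i (by simpa using hi)
    · rfl
    · rfl

theorem onWires_mem_unitaryGroup {w : κ → ι} (hw : Function.Injective w) {M : Op κ}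
    (hM : M ∈ Matrix.unitaryGroup (Reg κ) ℂ) :
    onWires w M ∈ Matrix.unitaryGroup (Reg ι) ℂ := by
  rw [Matrix.mem_unitaryGroup_iff, Matrix.star_eq_conjTranspose] at hM ⊢
  rw [conjTranspose_onWires, onWires_mul hw, hM, onWires_one]

theorem onWires_equiv_comp {ι' : Type} [Fintype ι'] [DecidableEq ι'] (e : ι ≃ ι') (w : κ → ι)
    (M : Op κ) :
    onWires (e ∘ w) M = (onWires w M).submatrix (fun x => x ∘ e) fun x => x ∘ e := by
  ext x y
  have h : (∀ i, (∀ j, (e ∘ w) j ≠ i) → x i = y i) ↔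
      ∀ i, (∀ j, w j ≠ i) → (x ∘ e) i = (y ∘ e) i := by
    rw [← e.forall_congr_right]
    simp
  simp only [onWires, Matrix.of_apply, Matrix.submatrix_apply, h]
  rfl

end OnWires

/-! ## Gates are unitary -/

theorem hadamard_mem_unitaryGroup : hadamard ∈ Matrix.unitaryGroup (Reg (Fin 1)) ℂ := by
  have h2 : ((Real.sqrt 2 : ℂ))⁻¹ * ((Real.sqrt 2 : ℂ))⁻¹ = 2⁻¹ := by
    rw [← mul_inv, ← Complex.ofReal_mul, Real.mul_self_sqrt (by norm_num)]
    norm_num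
  rw [Matrix.mem_unitaryGroup_iff, Matrix.star_eq_conjTranspose]
  ext x y
  have hxy : x = y ↔ x 0 = y 0 := by rw [funext_iff, Fin.forall_fin_one]
  rw [Matrix.mul_apply, ← (Equiv.funUnique (Fin 1) Bool).symm.sum_comp]
  simp only [hadamard, Matrix.of_apply, Matrix.conjTranspose_apply, Matrix.one_apply, hxy,
    Fintype.sum_bool]
  cases x 0 <;> cases y 0 <;> simp [h2] <;> norm_num

theorem tMatrix_mem_unitaryGroup : tMatrix ∈ Matrix.unitaryGroup (Reg (Fin 1)) ℂ := by
  rw [Matrix.mem_unitaryGroup_iff, Matrix.star_eq_conjTranspose, tMatrix,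
    Matrix.diagonal_conjTranspose, Matrix.diagonal_mul_diagonal, ← Matrix.diagonal_one]
  congr 1
  ext x
  simp only [Pi.star_apply]
  split_ifs
  · rw [Complex.star_def, ← Complex.exp_conj, ← Complex.exp_add]
    simp [Complex.conj_ofReal, neg_div, map_ofNat]
  · simp

theorem cnotMatrix_mem_unitaryGroup : cnotMatrix ∈ Matrix.unitaryGroup (Reg (Fin 2)) ℂ := by
  rw [Matrix.mem_unitaryGroup_iff, Matrix.star_eq_conjTranspose]
  ext x y
  have hxy : x = y ↔ x 0 = y 0 ∧ x 1 = y 1 := by rw [funext_iff, Fin.forall_fin_two]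
  rw [Matrix.mul_apply, ← (finTwoArrowEquiv Bool).symm.sum_comp, Fintype.sum_prod_type]
  simp only [cnotMatrix, Matrix.of_apply, Matrix.conjTranspose_apply, Matrix.one_apply, hxy,
    Fintype.sum_bool, finTwoArrowEquiv_symm_apply]
  cases x 0 <;> cases y 0 <;> cases x 1 <;> cases y 1 <;> simp

theorem eq_elim_iff {ι : Type} {a : ℕ} (x : Reg (ι ⊕ Fin a)) (i : Reg ι) :
    x = Sum.elim i (fun _ => false) ↔ x ∘ Sum.inl = i ∧ ∀ j, x (Sum.inr j) = false := by
  rw [funext_iff, Sum.forall, funext_iff]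
  rfl

section Circuits

variable {ι ι' κ : Type} [Fintype ι] [DecidableEq ι] [Fintype ι'] [DecidableEq ι'] [Fintype κ]
  [DecidableEq κ]

theorem Gate.op_mem_unitaryGroup (g : Gate ι) : g.op ∈ Matrix.unitaryGroup (Reg ι) ℂ := by
  cases g with
  | h i =>
    exact onWires_mem_unitaryGroup (Function.injective_of_subsingleton _) hadamard_mem_unitaryGroup
  | t i =>
    exact onWires_mem_unitaryGroup (Function.injective_of_subsingleton _) tMatrix_mem_unitaryGroup
  | cnot c d ne =>
    refine onWires_mem_unitaryGroup ?_ cnotMatrix_mem_unitaryGroup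
    intro i j hij
    fin_cases i <;> fin_cases j <;> simp_all [eq_comm]

/-! ## Circuits -/

theorem foldl_mul_eq_circuitOp_mul (l : List (Op ι)) (N : Op ι) :
    l.foldl (fun M g => g * M) N = circuitOp l * N := by
  induction l generalizing N with
  | nil => simp [circuitOp]
  | cons g l ih => rw [circuitOp, List.foldl_cons, List.foldl_cons, ih, ih, mul_one, mul_assoc]

theorem circuitOp_nil : circuitOp ([] : List (Op ι)) = 1 := rfl

theorem circuitOp_cons (g : Op ι) (l : List (Op ι)) : circuitOp (g :: l) = circuitOp l * g := by
  rw [circuitOp, List.foldl_cons, foldl_mul_eq_circuitOp_mul, mul_one]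

theorem circuitOp_append (l l' : List (Op ι)) :
    circuitOp (l ++ l') = circuitOp l' * circuitOp l := by
  rw [circuitOp, List.foldl_append, foldl_mul_eq_circuitOp_mul]
  rfl

theorem circuitOp_mem_unitaryGroup {l : List (Op ι)}
    (h : ∀ g ∈ l, g ∈ Matrix.unitaryGroup (Reg ι) ℂ) :
    circuitOp l ∈ Matrix.unitaryGroup (Reg ι) ℂ := by
  induction l with
  | nil => exact one_mem _
  | cons g l ih =>
    rw [circuitOp_cons]
    exact mul_mem (ih fun g' hg' => h g' (List.mem_cons_of_mem _ hg'))
      (h g List.mem_cons_self)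

/-- Relabelling of the basis of a register along a relabelling of its wires. -/
def regEquiv (e : ι ≃ ι') : Reg ι' ≃ Reg ι := (e.arrowCongr (Equiv.refl Bool)).symm

theorem circuitOp_submatrix (e : ι ≃ ι') (l : List (Op ι)) :
    circuitOp (l.map fun M => M.submatrix (regEquiv e) (regEquiv e))
      = (circuitOp l).submatrix (regEquiv e) (regEquiv e) := by
  induction l with
  | nil => rw [List.map_nil, circuitOp_nil, circuitOp_nil, Matrix.submatrix_one_equiv]
  | cons g l ih => rw [List.map_cons, circuitOp_cons, circuitOp_cons, ih, Matrix.submatrix_mul_equiv]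

/-- The isometry that adds `a` ancillas. -/
def ancillaIsometry (ι : Type) [Fintype ι] [DecidableEq ι] (a : ℕ) :
    Matrix (Reg (ι ⊕ Fin a)) (Reg ι) ℂ :=
  Matrix.of fun x i => if x = Sum.elim i (fun _ => false) then 1 else 0

theorem mul_ancillaIsometry_apply {α : Type} (a : ℕ) (N : Matrix α (Reg (ι ⊕ Fin a)) ℂ) (x : α)
    (i : Reg ι) : (N * ancillaIsometry ι a) x i = N x (Sum.elim i fun _ => false) := by
  simp [ancillaIsometry, Matrix.mul_apply]

theorem conjTranspose_ancillaIsometry_mul (a : ℕ) :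
    (ancillaIsometry ι a)ᴴ * ancillaIsometry ι a = 1 := by
  ext i j
  have h : (Sum.elim j (fun _ : Fin a => false) = Sum.elim i fun _ => false) ↔ i = j :=
    ⟨fun h => by simpa using congrArg (· ∘ Sum.inl) h.symm, fun h => by rw [h]⟩
  rw [mul_ancillaIsometry_apply, Matrix.conjTranspose_apply, ancillaIsometry, Matrix.of_apply,
    Matrix.one_apply]
  simp only [h]
  split_ifs <;> simp

theorem ancillaIsometry_mul_apply {α : Type} (a : ℕ) (N : Matrix (Reg ι) α ℂ)
    (x : Reg (ι ⊕ Fin a)) (y : α) :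
    (ancillaIsometry ι a * N) x y
      = if ∀ j, x (Sum.inr j) = false then N (x ∘ Sum.inl) y else 0 := by
  rw [Matrix.mul_apply]
  simp only [ancillaIsometry, Matrix.of_apply, eq_elim_iff, ite_mul, one_mul, zero_mul]
  by_cases h : ∀ j, x (Sum.inr j) = false <;> simp [h]

/-- This turns the state before measurement into `K * ρ * Kᴴ` with an isometry `K`, from which
linearity, positivity and normalisation of the output probabilities are read off. -/
theorem withAncillas_eq (a : ℕ) (ρ : Op ι) :
    withAncillas a ρ = ancillaIsometry ι a * ρ * (ancillaIsometry ι a)ᴴ := by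
  ext x y
  have h : ∀ M : Matrix (Reg ι) (Reg (ι ⊕ Fin a)) ℂ, ancillaIsometry ι a * M
      = Matrix.of fun x y => if ∀ j, x (Sum.inr j) = false then M (x ∘ Sum.inl) y else 0 := by
    intro M
    ext x y
    rw [ancillaIsometry_mul_apply, Matrix.of_apply]
  have h2 : ρ * (ancillaIsometry ι a)ᴴ = (ancillaIsometry ι a * ρᴴ)ᴴ := by
    rw [Matrix.conjTranspose_mul, Matrix.conjTranspose_conjTranspose]
  rw [Matrix.mul_assoc, h2, ancillaIsometry_mul_apply, Matrix.conjTranspose_apply,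
    ancillaIsometry_mul_apply, Matrix.conjTranspose_apply]
  simp only [withAncillas, Matrix.of_apply, forall_and]
  split_ifs <;> simp_all

/-- An operator that does not touch the ancillas may act before they are added. This later moves the
oracle queries onto the input state. -/
theorem onWires_inl_mul_ancillaIsometry (w : κ → ι) (M : Op κ) (a : ℕ) :
    onWires (fun k => (Sum.inl (w k) : ι ⊕ Fin a)) M * ancillaIsometry ι a
      = ancillaIsometry ι a * onWires w M := by
  ext x i
  rw [mul_ancillaIsometry_apply, ancillaIsometry_mul_apply]
  simp only [onWires, Matrix.of_apply, Sum.forall, Sum.inl.injEq, ne_eq, reduceCtorEq,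
    not_false_eq_true, implies_true, forall_const, Sum.elim_inl, Sum.elim_inr]
  by_cases h : ∀ j, x (Sum.inr j) = false
  · simp only [h, implies_true, and_true, if_true]
    rfl
  · simp only [h, and_false, if_false]

theorem circuitOp_inl_mul_ancillaIsometry {σ : Type} (w : σ → κ → ι) (M : Op κ) (a : ℕ)
    (l : List σ) :
    circuitOp (l.map fun s => onWires (fun k => (Sum.inl (w s k) : ι ⊕ Fin a)) M)
        * ancillaIsometry ι a
      = ancillaIsometry ι a * circuitOp (l.map fun s => onWires (w s) M) := by
  induction l with
  | nil => simp [circuitOp_nil]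
  | cons s l ih =>
    rw [List.map_cons, List.map_cons, circuitOp_cons, circuitOp_cons, Matrix.mul_assoc,
      onWires_inl_mul_ancillaIsometry, ← Matrix.mul_assoc, ih, Matrix.mul_assoc]

/-! ## Output probabilities -/

theorem IsDensity.average {α K : Type} [Fintype α] [Fintype K] [Nonempty K]
    {ρ : K → Matrix α α ℂ} (h : ∀ k, IsDensity (ρ k)) :
    IsDensity ((Fintype.card K : ℂ)⁻¹ • ∑ k, ρ k) := by
  refine ⟨(Matrix.posSemidef_sum _ fun k _ => (h k).1).smul ?_, ?_⟩
  · rw [inv_nonneg]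
    exact Nat.cast_nonneg _
  · simp [Matrix.trace_smul, Matrix.trace_sum, (h _).2]

theorem IsDensity.submatrix_equiv {α β : Type} [Fintype α] [Fintype β] {ρ : Matrix α α ℂ}
    (h : IsDensity ρ) (e : β ≃ α) : IsDensity (ρ.submatrix e e) :=
  ⟨h.1.submatrix e, by rw [← h.2, Matrix.trace, Matrix.trace, ← e.sum_comp]; rfl⟩

theorem keyAverage_prod {K L : Type} [Fintype K] [Fintype L] (f : K × L → ℝ) :
    keyAverage f = keyAverage fun k => keyAverage fun l => f (k, l) := by
  simp only [keyAverage, Fintype.sum_prod_type, Fintype.card_prod, ← Finset.sum_div]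
  rw [div_div, mul_comm (Fintype.card K), Nat.cast_mul]

namespace Algorithm

variable {G : Type → Type}

/-- The isometry implemented by an algorithm before its measurement. -/
def isometry (A : Algorithm G ι) (sem : G (ι ⊕ Fin A.anc) → Op (ι ⊕ Fin A.anc)) :
    Matrix (Reg (ι ⊕ Fin A.anc)) (Reg ι) ℂ :=
  circuitOp (A.circuit.map sem) * ancillaIsometry ι A.anc

theorem conjTranspose_isometry_mul (A : Algorithm G ι)
    (sem : G (ι ⊕ Fin A.anc) → Op (ι ⊕ Fin A.anc))
    (h : ∀ g, sem g ∈ Matrix.unitaryGroup (Reg (ι ⊕ Fin A.anc)) ℂ) :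
    (A.isometry sem)ᴴ * A.isometry sem = 1 := by
  have hC : circuitOp (A.circuit.map sem) ∈ Matrix.unitaryGroup (Reg (ι ⊕ Fin A.anc)) ℂ := by
    refine circuitOp_mem_unitaryGroup fun g hg => ?_
    obtain ⟨g', -, rfl⟩ := List.mem_map.1 hg
    exact h g'
  rw [Matrix.mem_unitaryGroup_iff', Matrix.star_eq_conjTranspose] at hC
  rw [isometry, Matrix.conjTranspose_mul, Matrix.mul_assoc, ← Matrix.mul_assoc _ _
    (ancillaIsometry ι A.anc), hC, Matrix.one_mul, conjTranspose_ancillaIsometry_mul]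

/-- The output probability as a linear functional of the input operator. -/
def outputFunctional (A : Algorithm G ι) (sem : G (ι ⊕ Fin A.anc) → Op (ι ⊕ Fin A.anc))
    (b : Bool) : Op ι →ₗ[ℂ] ℂ where
  toFun ρ := ∑ x, if x A.out = b then (A.isometry sem * ρ * (A.isometry sem)ᴴ) x x else 0
  map_add' ρ τ := by
    rw [← Finset.sum_add_distrib]
    refine Finset.sum_congr rfl fun x _ => ?_
    rw [Matrix.mul_add, Matrix.add_mul, Matrix.add_apply]
    split_ifs <;> simp
  map_smul' c ρ := by
    rw [RingHom.id_apply, Finset.smul_sum]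
    refine Finset.sum_congr rfl fun x _ => ?_
    rw [Matrix.mul_smul, Matrix.smul_mul, Matrix.smul_apply]
    split_ifs <;> simp

theorem outputProb_eq_sum (A : Algorithm G ι) (sem : G (ι ⊕ Fin A.anc) → Op (ι ⊕ Fin A.anc))
    (ρ : Op ι) (b : Bool) :
    A.outputProb sem ρ b
      = ∑ x, if x A.out = b then ((A.isometry sem * ρ * (A.isometry sem)ᴴ) x x).re else 0 := by
  rw [outputProb]
  simp only [withAncillas_eq, isometry, Matrix.conjTranspose_mul, Matrix.mul_assoc]

theorem outputProb_eq_re (A : Algorithm G ι) (sem : G (ι ⊕ Fin A.anc) → Op (ι ⊕ Fin A.anc))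
    (ρ : Op ι) (b : Bool) : A.outputProb sem ρ b = (A.outputFunctional sem b ρ).re := by
  rw [outputProb_eq_sum]
  change _ = (∑ x, _ : ℂ).re
  rw [Complex.re_sum]
  refine Finset.sum_congr rfl fun x _ => ?_
  split_ifs <;> simp

theorem outputProb_average {K : Type} [Fintype K] (A : Algorithm G ι)
    (sem : G (ι ⊕ Fin A.anc) → Op (ι ⊕ Fin A.anc)) (ρ : K → Op ι) (b : Bool) :
    A.outputProb sem ((Fintype.card K : ℂ)⁻¹ • ∑ k, ρ k) b
      = keyAverage fun k => A.outputProb sem (ρ k) b := by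
  have h : (Fintype.card K : ℂ)⁻¹ = (((Fintype.card K : ℝ)⁻¹ : ℝ) : ℂ) := by push_cast; rfl
  simp only [outputProb_eq_re, map_smul, map_sum, smul_eq_mul, h, Complex.re_ofReal_mul,
    Complex.re_sum, keyAverage]
  rw [div_eq_inv_mul]

theorem outputProb_nonneg (A : Algorithm G ι) (sem : G (ι ⊕ Fin A.anc) → Op (ι ⊕ Fin A.anc))
    {ρ : Op ι} (hρ : ρ.PosSemidef) (b : Bool) : 0 ≤ A.outputProb sem ρ b := by
  rw [outputProb_eq_sum]
  refine Finset.sum_nonneg fun x _ => ?_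
  split_ifs
  · exact (Complex.nonneg_iff.1 (hρ.mul_mul_conjTranspose_same (A.isometry sem)).diag_nonneg).1
  · exact le_rfl

/-- The two outcomes exhaust the diagonal of `K * ρ * Kᴴ`, whose trace is that of `ρ` because `K` is
an isometry. -/
theorem outputProb_add_eq_one (A : Algorithm G ι)
    (sem : G (ι ⊕ Fin A.anc) → Op (ι ⊕ Fin A.anc))
    (h : ∀ g, sem g ∈ Matrix.unitaryGroup (Reg (ι ⊕ Fin A.anc)) ℂ) {ρ : Op ι}
    (hρ : IsDensity ρ) : A.outputProb sem ρ false + A.outputProb sem ρ true = 1 := by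
  have h1 : (A.isometry sem * ρ * (A.isometry sem)ᴴ).trace = 1 := by
    rw [Matrix.trace_mul_comm, ← Matrix.mul_assoc, conjTranspose_isometry_mul A sem h,
      Matrix.one_mul, hρ.2]
  rw [outputProb_eq_sum, outputProb_eq_sum, ← Finset.sum_add_distrib, ← Complex.one_re, ← h1,
    Matrix.trace, Complex.re_sum]
  refine Finset.sum_congr rfl fun x _ => ?_
  rw [Matrix.diag_apply]
  cases x A.out <;> simp

theorem outputProb_le_one (A : Algorithm G ι)
    (sem : G (ι ⊕ Fin A.anc) → Op (ι ⊕ Fin A.anc))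
    (h : ∀ g, sem g ∈ Matrix.unitaryGroup (Reg (ι ⊕ Fin A.anc)) ℂ) {ρ : Op ι}
    (hρ : IsDensity ρ) (b : Bool) : A.outputProb sem ρ b ≤ 1 := by
  have h1 := A.outputProb_add_eq_one sem h hρ
  have h2 := A.outputProb_nonneg sem hρ.1 false
  have h3 := A.outputProb_nonneg sem hρ.1 true
  cases b <;> linarith

end Algorithm

/-! ## Relabelling the wires of an oracle algorithm -/

/-- Relabelling the wires of a gate. -/
def Gate.map (e : ι ≃ ι') : Gate ι → Gate ι'
  | .h i => .h (e i)
  | .t i => .t (e i)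
  | .cnot c d ne => .cnot (e c) (e d) (e.injective.ne ne)

/-- Relabelling the wires of an oracle gate. -/
def OracleGate.map (e : ι ≃ ι') : OracleGate κ ι → OracleGate κ ι'
  | .gate g => .gate (g.map e)
  | .query w => .query (w.trans e.toEmbedding)

theorem Gate.op_map (e : ι ≃ ι') (g : Gate ι) :
    (g.map e).op = g.op.submatrix (regEquiv e) (regEquiv e) := by
  cases g with
  | h i => exact onWires_equiv_comp e _ _
  | t i => exact onWires_equiv_comp e _ _
  | cnot c d ne =>
    refine Eq.trans ?_ (onWires_equiv_comp e _ _)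
    change onWires _ _ = _
    congr 1
    ext i
    fin_cases i <;> rfl

theorem OracleGate.op_map (e : ι ≃ ι') (U : QU κ) (g : OracleGate κ ι) :
    (g.map e).op U = (g.op U).submatrix (regEquiv e) (regEquiv e) := by
  cases g with
  | gate g => exact g.op_map e
  | query w => exact onWires_equiv_comp e w U

/-- Relabelling the input wires of an oracle algorithm. -/
def Algorithm.relabel (e : ι ≃ ι') (A : Algorithm (OracleGate κ) ι) :
    Algorithm (OracleGate κ) ι' where
  anc := A.anc
  circuit := A.circuit.map (OracleGate.map (e.sumCongr (Equiv.refl (Fin A.anc))))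
  out := e.sumCongr (Equiv.refl (Fin A.anc)) A.out

/-- Needed because `OracleAdversary` labels its wires by `Fin (wires n)`, while the ciphertexts come
as blocks and a reference. -/
theorem Algorithm.outputProb_relabel (e : ι ≃ ι') (A : Algorithm (OracleGate κ) ι) (U : QU κ)
    (ρ : Op ι) (b : Bool) :
    (A.relabel e).outputProb (OracleGate.op U) (ρ.submatrix (regEquiv e) (regEquiv e)) b
      = A.outputProb (OracleGate.op U) ρ b := by
  set f := e.sumCongr (Equiv.refl (Fin A.anc)) with hf
  have h1 : withAncillas A.anc (ρ.submatrix (regEquiv e) (regEquiv e))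
      = (withAncillas A.anc ρ).submatrix (regEquiv f) (regEquiv f) := rfl
  have h2 : (circuitOp ((A.relabel e).circuit.map (OracleGate.op U)) : Op (ι' ⊕ Fin A.anc))
      = (circuitOp (A.circuit.map (OracleGate.op U))).submatrix (regEquiv f) (regEquiv f) := by
    rw [← circuitOp_submatrix, List.map_map]
    change circuitOp ((A.circuit.map (OracleGate.map f)).map (OracleGate.op U)) = _
    rw [List.map_map]
    congr 2
    ext1 g
    exact OracleGate.op_map f U g
  have h3 : ∀ (C : Op (ι' ⊕ Fin A.anc)) (D : Op (ι ⊕ Fin A.anc)),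
      C = D.submatrix (regEquiv f) (regEquiv f) →
      (∑ x : Reg (ι' ⊕ Fin A.anc), if x (f A.out) = b then
        ((C * withAncillas A.anc (ρ.submatrix (regEquiv e) (regEquiv e)) * Cᴴ) x x).re else 0)
      = ∑ x : Reg (ι ⊕ Fin A.anc), if x A.out = b then
        ((D * withAncillas A.anc ρ * Dᴴ) x x).re else 0 := by
    rintro C D rfl
    rw [h1, Matrix.conjTranspose_submatrix, Matrix.submatrix_mul_equiv,
      Matrix.submatrix_mul_equiv, ← (regEquiv f).sum_comp]
    rfl
  exact h3 _ _ h2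

end Circuits

/-! ## Parallel queries -/

theorem tensorPow_mul {α : Type} [Fintype α] (t : ℕ) (M N : Matrix α α ℂ) :
    tensorPow t (M * N) = tensorPow t M * tensorPow t N := by
  ext x y
  simp only [tensorPow, Matrix.of_apply, Matrix.mul_apply, ← Finset.prod_mul_distrib]
  rw [Finset.prod_univ_sum, Fintype.piFinset_univ]

theorem tensorPow_one {α : Type} [Fintype α] [DecidableEq α] (t : ℕ) :
    tensorPow t (1 : Matrix α α ℂ) = 1 := by
  ext x y
  simp only [tensorPow, Matrix.of_apply, Matrix.one_apply, funext_iff]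
  rw [Finset.prod_ite_zero]
  simp

theorem conjTranspose_tensorPow {α : Type} (t : ℕ) (M : Matrix α α ℂ) :
    (tensorPow t M)ᴴ = tensorPow t Mᴴ := by
  ext x y
  simp [tensorPow, Matrix.conjTranspose_apply]

section Queries

variable {t z r : ℕ}

/-- The wires of the `s`-th of `t` registers. -/
def blockWires (r : ℕ) (s : Fin t) : Fin z ↪ (Fin t × Fin z) ⊕ Fin r :=
  ⟨fun i => Sum.inl (s, i), fun i j h => by simpa using h⟩

theorem blockWires_apply (s : Fin t) (i : Fin z) : blockWires r s i = Sum.inl (s, i) := rfl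

/-- The basis of `t` registers and a reference, as the basis of one register. -/
def flattenEquiv (t z r : ℕ) :
    Reg ((Fin t × Fin z) ⊕ Fin r) ≃ (Fin t → Reg (Fin z)) × Reg (Fin r) :=
  (Equiv.sumArrowEquivProdArrow _ _ _).trans
    ((Equiv.curry _ _ _).prodCongr (Equiv.refl _))

theorem flatten_eq_submatrix
    (X : Matrix ((Fin t → Reg (Fin z)) × Reg (Fin r)) ((Fin t → Reg (Fin z)) × Reg (Fin r)) ℂ) :
    flatten X = X.submatrix (flattenEquiv t z r) (flattenEquiv t z r) := rfl

/-- Induction on the last gate applied: it acts on a block that the earlier gates leave alone, so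
the entry acquires one more factor. Blocks outside `l` and the reference must agree on both sides.
-/
theorem circuitOp_blockWires_apply (M : Op (Fin z)) (l : List (Fin t)) (hl : l.Nodup)
    (x y : Reg ((Fin t × Fin z) ⊕ Fin r)) :
    circuitOp (l.map fun s => onWires (blockWires r s) M) x y
      = if (∀ s ∉ l, x ∘ blockWires r s = y ∘ blockWires r s) ∧ x ∘ Sum.inr = y ∘ Sum.inr then
        (l.map fun s => M (x ∘ blockWires r s) (y ∘ blockWires r s)).prod else 0 := by
  induction l using List.reverseRecOn generalizing x with
  | nil =>
    rw [List.map_nil, circuitOp_nil, Matrix.one_apply]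
    have h : x = y ↔ (∀ s ∉ ([] : List (Fin t)), x ∘ blockWires r s = y ∘ blockWires r s) ∧
        x ∘ Sum.inr = y ∘ Sum.inr := by
      simp [funext_iff, Sum.forall, blockWires_apply]
    simp only [h]
    rfl
  | append_singleton l s ih =>
    have hs : s ∉ l := fun h => (List.nodup_append.1 hl).2.2 s h s (by simp) rfl
    have hl' : l.Nodup := (List.nodup_append.1 hl).1
    have hw : Function.Injective (blockWires (z := z) r s) := (blockWires r s).injective
    rw [List.map_append, List.map_singleton, circuitOp_append, circuitOp_cons, circuitOp_nil,
      one_mul, onWires_mul_apply hw]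
    have h1 : ∀ (v : Reg (Fin z)) (s' : Fin t), s' ≠ s →
        Function.extend (blockWires r s) v x ∘ blockWires r s' = x ∘ blockWires r s' := by
      intro v s' hs'
      ext i
      exact Function.extend_apply' _ _ _ fun ⟨j, hj⟩ =>
        hs' (Prod.ext_iff.1 (Sum.inl_injective hj)).1.symm
    have h2 : ∀ v : Reg (Fin z),
        Function.extend (blockWires r s) v x ∘ Sum.inr = x ∘ Sum.inr := by
      intro v
      ext i
      exact Function.extend_apply' _ _ _ fun ⟨j, hj⟩ => by simp [blockWires_apply] at hj
    -- As `s ∉ l`, the earlier gates fix block `s`, so only `v = y ∘ blockWires r s` survives in the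
    -- sum over intermediate values.
    have h3 : ∀ v : Reg (Fin z), circuitOp (l.map fun s => onWires (blockWires r s) M)
        (Function.extend (blockWires r s) v x) y
        = if v = y ∘ blockWires r s then
          (if (∀ s' ∉ l ++ [s], x ∘ blockWires r s' = y ∘ blockWires r s') ∧
              x ∘ Sum.inr = y ∘ Sum.inr then
            (l.map fun s => M (x ∘ blockWires r s) (y ∘ blockWires r s)).prod else 0)
          else 0 := by
      intro v
      rw [ih hl', h2, ← ite_and]
      have hc : ((∀ s' ∉ l, Function.extend (blockWires r s) v x ∘ blockWires r s'
            = y ∘ blockWires r s') ∧ x ∘ Sum.inr = y ∘ Sum.inr) ↔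
          v = y ∘ blockWires r s ∧
            (∀ s' ∉ l ++ [s], x ∘ blockWires r s' = y ∘ blockWires r s') ∧
              x ∘ Sum.inr = y ∘ Sum.inr := by
        rw [← and_assoc]
        refine and_congr_left fun _ => ⟨fun h => ⟨?_, fun s' hs' => ?_⟩, fun h s' hs' => ?_⟩
        · rw [← h s hs, extend_comp_self hw]
        · rw [List.mem_append, List.mem_singleton, not_or] at hs'
          rw [← h s' hs'.1, h1 v s' hs'.2]
        · by_cases hss : s' = s
          · rw [hss, extend_comp_self hw, h.1]
          · rw [h1 v s' hss]
            exact h.2 s' (by simp [hs', hss])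
      have hp : (l.map fun s' => M (Function.extend (blockWires r s) v x ∘ blockWires r s')
          (y ∘ blockWires r s'))
          = l.map fun s => M (x ∘ blockWires r s) (y ∘ blockWires r s) := by
        refine List.map_congr_left fun s' hs' => ?_
        rw [h1 v s' (fun h => hs (h ▸ hs'))]
      rw [hp]
      exact if_congr hc rfl rfl
    simp only [h3, mul_ite, mul_zero, Finset.sum_ite_eq', Finset.mem_univ,
      if_true, List.map_append, List.map_singleton, List.prod_append, List.prod_singleton]
    split_ifs
    · exact mul_comm _ _
    · rfl

theorem circuitOp_blockWires (M : Op (Fin z)) :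
    circuitOp ((List.finRange t).map fun s => onWires (blockWires r s) M)
      = (tensorPow t M ⊗ₖ (1 : Op (Fin r))).submatrix (flattenEquiv t z r) (flattenEquiv t z r) := by
  ext x y
  rw [circuitOp_blockWires_apply M _ (List.nodup_finRange t), ← Fin.prod_univ_def,
    Matrix.submatrix_apply, Matrix.kroneckerMap_apply, Matrix.one_apply, mul_ite, mul_one, mul_zero]
  refine if_congr ?_ rfl rfl
  simp only [List.mem_finRange, not_true_eq_false, false_imp_iff, implies_true, true_and]
  rfl

/-- The oracle algorithm that applies the oracle to each of `t` registers and then runs `A`. -/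
def Algorithm.afterQueries (A : Algorithm Gate ((Fin t × Fin z) ⊕ Fin r)) :
    Algorithm (OracleGate (Fin z)) ((Fin t × Fin z) ⊕ Fin r) where
  anc := A.anc
  circuit := (List.finRange t).map (fun s => .query ((blockWires r s).trans .inl)) ++
    A.circuit.map .gate
  out := A.out

/-- The queries avoid the ancillas, so they pass through the ancilla isometry; acting on disjoint
blocks, together they are `U^{⊗t} ⊗ 1` on the input state. -/
theorem Algorithm.outputProb_afterQueries (A : Algorithm Gate ((Fin t × Fin z) ⊕ Fin r))
    (U : QU (Fin z))
    (X : Matrix ((Fin t → Reg (Fin z)) × Reg (Fin r)) ((Fin t → Reg (Fin z)) × Reg (Fin r)) ℂ)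
    (b : Bool) :
    A.afterQueries.outputProb (OracleGate.op U) (flatten X) b
      = A.outputProb Gate.op (flatten ((tensorPow t (U : Op (Fin z)) ⊗ₖ (1 : Op (Fin r))) * X *
        (tensorPow t (U : Op (Fin z)) ⊗ₖ (1 : Op (Fin r)))ᴴ)) b := by
  set Q := tensorPow t (U : Op (Fin z)) ⊗ₖ (1 : Op (Fin r)) with hQ
  have h1 : (circuitOp (A.afterQueries.circuit.map (OracleGate.op U)) :
      Op (((Fin t × Fin z) ⊕ Fin r) ⊕ Fin A.anc))
      = circuitOp (A.circuit.map Gate.op) * circuitOp ((List.finRange t).map fun s =>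
        onWires (fun k => (Sum.inl (blockWires r s k) : ((Fin t × Fin z) ⊕ Fin r) ⊕ Fin A.anc))
          (U : Op (Fin z))) := by
    simp only [afterQueries, List.map_append, List.map_map, circuitOp_append]
    rfl
  have h2 : (A.afterQueries.isometry (OracleGate.op U) :
      Matrix (Reg (((Fin t × Fin z) ⊕ Fin r) ⊕ Fin A.anc)) _ ℂ)
      = A.isometry Gate.op * Q.submatrix (flattenEquiv t z r) (flattenEquiv t z r) := by
    have h := congrArg (fun C : Op (((Fin t × Fin z) ⊕ Fin r) ⊕ Fin A.anc) =>
      C * ancillaIsometry ((Fin t × Fin z) ⊕ Fin r) A.anc) h1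
    refine Eq.trans h (Eq.trans (Matrix.mul_assoc _ _ _) ?_)
    rw [hQ, ← circuitOp_blockWires, isometry, Matrix.mul_assoc]
    exact congrArg (fun M : Matrix (Reg (((Fin t × Fin z) ⊕ Fin r) ⊕ Fin A.anc))
        (Reg ((Fin t × Fin z) ⊕ Fin r)) ℂ => circuitOp (A.circuit.map Gate.op) * M)
      (circuitOp_inl_mul_ancillaIsometry (fun s : Fin t => blockWires r s) (U : Op (Fin z)) A.anc
        (List.finRange t))
  have h3 : ∀ K : Matrix (Reg (((Fin t × Fin z) ⊕ Fin r) ⊕ Fin A.anc)) _ ℂ,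
      K = A.isometry Gate.op * Q.submatrix (flattenEquiv t z r) (flattenEquiv t z r) →
      (∑ x : Reg (((Fin t × Fin z) ⊕ Fin r) ⊕ Fin A.anc),
        if x A.out = b then ((K * flatten X * Kᴴ) x x).re else 0)
      = A.outputProb Gate.op (flatten (Q * X * Qᴴ)) b := by
    rintro K rfl
    have hX : flatten (Q * X * Qᴴ) = Q.submatrix (flattenEquiv t z r) (flattenEquiv t z r) *
        flatten X * (Q.submatrix (flattenEquiv t z r) (flattenEquiv t z r))ᴴ := by
      rw [flatten_eq_submatrix, flatten_eq_submatrix, Matrix.conjTranspose_submatrix,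
        Matrix.submatrix_mul_equiv, Matrix.submatrix_mul_equiv]
    rw [outputProb_eq_sum, hX]
    simp only [Matrix.conjTranspose_mul, Matrix.mul_assoc]
  rw [outputProb_eq_sum]
  exact h3 _ h2

end Queries

/-! ## The left-or-right oracle encrypts one of two inputs -/

section LeftRight

variable {α β γ : Type}

/-- Swaps a pair if `b` is set. -/
def swapIf (α : Type) (b : Bool) : α × α ≃ α × α := if b then Equiv.prodComm α α else Equiv.refl _

/-- The family of pairs with given encrypted components and given discarded components. -/
def pairEquiv (α : Type) (t : ℕ) (b : Bool) :
    (Fin t → α) × (Fin t → α) ≃ (Fin t → α × α) :=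
  (Equiv.arrowProdEquivProdArrow (Fin t) (fun _ => α) (fun _ => α)).symm.trans
    ((Equiv.refl _).arrowCongr (swapIf α b).symm)

/-- The state of the inputs that are encrypted, and of the reference. -/
def selectInput {t : ℕ} [Fintype α] (b : Bool)
    (X : Matrix ((Fin t → α × α) × γ) ((Fin t → α × α) × γ) ℂ) :
    Matrix ((Fin t → α) × γ) ((Fin t → α) × γ) ℂ :=
  ∑ c : Fin t → α, X.submatrix (fun p => (pairEquiv α t b (p.1, c), p.2))
    fun p => (pairEquiv α t b (p.1, c), p.2)

/-- Tracing out the selected inputs after the discarded ones traces out all pairs. The right side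
does not involve `b`: this is why left and right become indistinguishable. -/
theorem sum_selectInput {t : ℕ} [Fintype α] (b : Bool)
    (X : Matrix ((Fin t → α × α) × γ) ((Fin t → α × α) × γ) ℂ) (p q : γ) :
    ∑ i, selectInput b X (i, p) (i, q) = ∑ w, X (w, p) (w, q) := by
  rw [← (pairEquiv α t b).sum_comp, Fintype.sum_prod_type]
  refine Finset.sum_congr rfl fun i _ => ?_
  rw [selectInput, Matrix.sum_apply]
  rfl

theorem IsDensity.selectInput {t : ℕ} [Fintype α] [Fintype γ] (b : Bool)
    {X : Matrix ((Fin t → α × α) × γ) ((Fin t → α × α) × γ) ℂ} (hX : IsDensity X) :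
    IsDensity (selectInput b X) := by
  refine ⟨Matrix.posSemidef_sum _ fun c _ => hX.1.submatrix _, ?_⟩
  rw [← hX.2, Matrix.trace, Matrix.trace, Fintype.sum_prod_type_right, Fintype.sum_prod_type_right]
  exact Finset.sum_congr rfl fun p _ => sum_selectInput b X p p

/-- The partial trace of a matrix unit is a matrix unit or zero. Matrix units suffice because
`parallel` is defined through them. -/
theorem leftRight_single [Fintype α] [DecidableEq α] (Φ : Matrix α α ℂ →ₗ[ℂ] Matrix β β ℂ)
    (b : Bool) (u v : α × α) :
    leftRight Φ b (Matrix.single u v 1)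
      = if (swapIf α b u).2 = (swapIf α b v).2 then
        Φ (Matrix.single (swapIf α b u).1 (swapIf α b v).1 1) else 0 := by
  obtain ⟨u₁, u₂⟩ := u
  obtain ⟨v₁, v₂⟩ := v
  cases b
  · have h : ∀ c : α, (Matrix.of fun i j : α =>
          Matrix.single (u₁, u₂) (v₁, v₂) (1 : ℂ) (i, c) (j, c))
        = if c = u₂ then (if u₂ = v₂ then Matrix.single u₁ v₁ 1 else 0) else 0 := by
      intro c
      ext i j
      simp only [Matrix.of_apply, Matrix.single_apply, Prod.mk.injEq]
      split_ifs <;> simp_all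
    ext p q
    simp only [leftRight, Bool.false_eq_true, if_false, LinearMap.comp_apply, traceSnd,
      ampliateRight, LinearMap.coe_mk, AddHom.coe_mk, Matrix.of_apply, h, swapIf, Equiv.refl_apply]
    rw [Finset.sum_eq_single u₂ (fun c _ hc => by simp [hc]) (by simp), if_pos rfl]
    split_ifs <;> simp
  · have h : ∀ c : α, (Matrix.of fun i j : α =>
          Matrix.single (u₁, u₂) (v₁, v₂) (1 : ℂ) (c, i) (c, j))
        = if c = u₁ then (if u₁ = v₁ then Matrix.single u₂ v₂ 1 else 0) else 0 := by
      intro c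
      ext i j
      simp only [Matrix.of_apply, Matrix.single_apply, Prod.mk.injEq]
      split_ifs <;> simp_all
    ext p q
    simp only [leftRight, if_true, LinearMap.comp_apply, traceFst, ampliateLeft, LinearMap.coe_mk,
      AddHom.coe_mk, Matrix.of_apply, h, swapIf, Equiv.prodComm_apply, Prod.swap]
    rw [Finset.sum_eq_single u₁ (fun c _ hc => by simp [hc]) (by simp), if_pos rfl]
    split_ifs <;> simp

/-- Discarding commutes with encrypting the other component. From here on the bit enters only
through the state being encrypted. -/
theorem parallel_leftRight {t : ℕ} [Fintype α] [DecidableEq α]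
    (Φ : Matrix α α ℂ →ₗ[ℂ] Matrix β β ℂ) (b : Bool)
    (X : Matrix ((Fin t → α × α) × γ) ((Fin t → α × α) × γ) ℂ) :
    parallel t (leftRight Φ b) X = parallel t Φ (selectInput b X) := by
  ext p q
  simp only [parallel, Matrix.of_apply]
  have h : ∀ i c j d : Fin t → α,
      ∏ s, leftRight Φ b (Matrix.single (pairEquiv α t b (i, c) s) (pairEquiv α t b (j, d) s) 1)
        (p.1 s) (q.1 s)
      = if c = d then ∏ s, Φ (Matrix.single (i s) (j s) 1) (p.1 s) (q.1 s) else 0 := by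
    intro i c j d
    have hE : ∀ (i c : Fin t → α) s, swapIf α b (pairEquiv α t b (i, c) s) = (i s, c s) :=
      fun i c s => (swapIf α b).apply_symm_apply (i s, c s)
    have h1 : ∀ s, leftRight Φ b
        (Matrix.single (pairEquiv α t b (i, c) s) (pairEquiv α t b (j, d) s) 1) (p.1 s) (q.1 s)
        = if c s = d s then Φ (Matrix.single (i s) (j s) 1) (p.1 s) (q.1 s) else 0 := by
      intro s
      rw [leftRight_single, hE, hE]
      split_ifs <;> rfl
    rw [Finset.prod_congr rfl fun s _ => h1 s, Finset.prod_ite_zero]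
    simp only [Finset.mem_univ, true_imp_iff, funext_iff]
  simp only [← (pairEquiv α t b).sum_comp, Fintype.sum_prod_type, h, mul_ite, mul_zero,
    Finset.sum_ite_eq, Finset.mem_univ, if_true, selectInput, Matrix.sum_apply, Finset.sum_mul,
    Matrix.submatrix_apply]
  refine Finset.sum_congr rfl fun i _ => ?_
  rw [Finset.sum_comm]

end LeftRight

/-! ## Encryption with a fixed mixing string -/

section Encryption

variable {n l m t : ℕ}

/-- The basis state `|i⟩|0…0⟩|σ⟩`. -/
def padded (l : ℕ) (i : Reg (Fin n)) (σ : Reg (Fin m)) : Reg (Fin (n + l + m)) :=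
  joinRegs n l m ((i, fun _ => false), σ)

theorem padded_inj {i j : Reg (Fin n)} {σ τ : Reg (Fin m)} :
    padded l i σ = padded l j τ ↔ i = j ∧ σ = τ := by
  rw [padded, padded, (joinRegs n l m).apply_eq_iff_eq]
  simp

/-- The maximally mixed register is the uniform mixture of its basis states. -/
theorem reindex_single (i j : Reg (Fin n)) :
    Matrix.reindex (joinRegs n l m) (joinRegs n l m)
        ((Matrix.single i j (1 : ℂ) ⊗ₖ zeroState (Fin l)) ⊗ₖ maxMixed (Fin m))
      = ((2 : ℂ) ^ m)⁻¹ • ∑ σ, Matrix.single (padded l i σ) (padded l j σ) 1 := by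
  ext x y
  obtain ⟨⟨⟨x₁, x₂⟩, x₃⟩, rfl⟩ := (joinRegs n l m).surjective x
  obtain ⟨⟨⟨y₁, y₂⟩, y₃⟩, rfl⟩ := (joinRegs n l m).surjective y
  simp only [Matrix.reindex_apply, Matrix.submatrix_apply, Equiv.symm_apply_apply,
    Matrix.kroneckerMap_apply, Matrix.smul_apply, Matrix.sum_apply, zeroState, maxMixed, padded,
    Matrix.single_apply, (joinRegs n l m).apply_eq_iff_eq, Prod.mk.injEq, Matrix.one_apply,
    Fintype.card_fin, smul_eq_mul]
  by_cases h : i = x₁ ∧ j = y₁ ∧ (fun _ => false) = x₂ ∧ (fun _ => false) = y₂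
  · obtain ⟨rfl, rfl, rfl, rfl⟩ := h
    simp only [and_self, if_true, true_and, mul_one, one_mul]
    congr 1
    rw [Finset.sum_eq_single x₃ (fun σ _ hσ => if_neg fun h => hσ h.1) (by simp)]
    simp
  · rw [Finset.sum_eq_zero fun σ _ => if_neg fun h' => h ⟨h'.1.1.1, h'.2.1.1, h'.1.1.2, h'.2.1.2⟩,
      mul_zero]
    rw [ite_zero_mul_ite_zero, if_neg (fun h' => h ⟨h'.1.1, h'.1.2, h'.2.1, h'.2.2⟩), zero_mul]

theorem padAndScramble_single (V : QU (Fin (n + l + m))) (i j : Reg (Fin n))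
    (p q : Reg (Fin (n + l + m))) :
    padAndScramble n l m V (Matrix.single i j 1) p q
      = ((2 : ℂ) ^ m)⁻¹ * ∑ σ, (V : Op (Fin (n + l + m))) p (padded l i σ) *
        star ((V : Op (Fin (n + l + m))) q (padded l j σ)) := by
  rw [padAndScramble_apply, reindex_single, Matrix.mul_smul, Matrix.smul_mul, Matrix.smul_apply,
    smul_eq_mul, Matrix.mul_sum, Matrix.sum_mul, Matrix.sum_apply]
  congr 1
  refine Finset.sum_congr rfl fun σ _ => ?_
  rw [Matrix.mul_apply, Finset.sum_eq_single (padded l j σ), Matrix.mul_single_apply_same, mul_one,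
    Matrix.conjTranspose_apply]
  · intro b _ hb
    rw [Matrix.mul_single_apply_of_ne _ _ _ _ _ hb, zero_mul]
  · simp

/-- The isometry that appends zeros and the strings `σ s` to `t` registers and applies `V` to each
of them. -/
def scrambleIsometry (γ : Type) [DecidableEq γ] (V : Op (Fin (n + l + m)))
    (σ : Fin t → Reg (Fin m)) :
    Matrix ((Fin t → Reg (Fin (n + l + m))) × γ) ((Fin t → Reg (Fin n)) × γ) ℂ :=
  ((tensorPow t V).submatrix id fun i s => padded l (i s) (σ s)) ⊗ₖ 1

variable {γ : Type} [Fintype γ] [DecidableEq γ]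

theorem conjTranspose_scrambleIsometry_mul (V : QU (Fin (n + l + m))) (σ : Fin t → Reg (Fin m)) :
    (scrambleIsometry γ (V : Op (Fin (n + l + m))) σ)ᴴ *
        scrambleIsometry γ (V : Op (Fin (n + l + m))) σ = 1 := by
  have hV : ((V : Op (Fin (n + l + m))))ᴴ * (V : Op (Fin (n + l + m))) = 1 :=
    (Matrix.mem_unitaryGroup_iff').1 V.2
  have hinj : Function.Injective fun (i : Fin t → Reg (Fin n)) s => padded l (i s) (σ s) :=
    fun i j h => funext fun s => (padded_inj.1 (congrFun h s)).1
  rw [scrambleIsometry, Matrix.conjTranspose_kronecker, ← Matrix.mul_kronecker_mul,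
    Matrix.conjTranspose_submatrix, ← Equiv.coe_refl, Matrix.submatrix_mul_equiv,
    conjTranspose_tensorPow, ← tensorPow_mul, hV, tensorPow_one, Matrix.submatrix_one _ hinj]
  simp

theorem tensorPow_kronecker_mul_scrambleIsometry (U V : Op (Fin (n + l + m)))
    (σ : Fin t → Reg (Fin m)) :
    (tensorPow t U ⊗ₖ (1 : Matrix γ γ ℂ)) * scrambleIsometry γ V σ
      = scrambleIsometry γ (U * V) σ := by
  rw [scrambleIsometry, ← Matrix.mul_kronecker_mul, Matrix.one_mul, scrambleIsometry,
    tensorPow_mul]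
  rfl

/-- The encrypted state, with mixing strings `σ`. -/
def scramble (V : Op (Fin (n + l + m))) (σ : Fin t → Reg (Fin m))
    (Y : Matrix ((Fin t → Reg (Fin n)) × γ) ((Fin t → Reg (Fin n)) × γ) ℂ) :
    Matrix ((Fin t → Reg (Fin (n + l + m))) × γ) ((Fin t → Reg (Fin (n + l + m))) × γ) ℂ :=
  scrambleIsometry γ V σ * Y * (scrambleIsometry γ V σ)ᴴ

theorem IsDensity.scramble (V : QU (Fin (n + l + m))) (σ : Fin t → Reg (Fin m))
    {Y : Matrix ((Fin t → Reg (Fin n)) × γ) ((Fin t → Reg (Fin n)) × γ) ℂ} (hY : IsDensity Y) :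
    IsDensity (scramble (V : Op (Fin (n + l + m))) σ Y) := by
  refine ⟨hY.1.mul_mul_conjTranspose_same _, ?_⟩
  rw [QCrypto.scramble, Matrix.trace_mul_comm, ← Matrix.mul_assoc,
    conjTranspose_scrambleIsometry_mul, Matrix.one_mul, hY.2]

theorem conjugate_scramble (U V : Op (Fin (n + l + m))) (σ : Fin t → Reg (Fin m))
    (Y : Matrix ((Fin t → Reg (Fin n)) × γ) ((Fin t → Reg (Fin n)) × γ) ℂ) :
    (tensorPow t U ⊗ₖ (1 : Matrix γ γ ℂ)) * scramble V σ Y *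
        (tensorPow t U ⊗ₖ (1 : Matrix γ γ ℂ))ᴴ
      = scramble (U * V) σ Y := by
  rw [scramble, scramble, ← tensorPow_kronecker_mul_scrambleIsometry, Matrix.conjTranspose_mul]
  simp only [Matrix.mul_assoc]

/-- The same `σ` labels the columns of `V` and of its conjugate, while `i` and `j` vary freely; the
Haar moments apply to exactly these monomials. -/
theorem scramble_apply (V : Op (Fin (n + l + m))) (σ : Fin t → Reg (Fin m))
    (Y : Matrix ((Fin t → Reg (Fin n)) × γ) ((Fin t → Reg (Fin n)) × γ) ℂ)
    (p q : (Fin t → Reg (Fin (n + l + m))) × γ) :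
    scramble V σ Y p q = ∑ i, ∑ j, Y (i, p.2) (j, q.2) *
      entryMonomial p.1 q.1 (fun s => padded l (i s) (σ s)) (fun s => padded l (j s) (σ s)) V := by
  rw [Finset.sum_comm, scramble, Matrix.mul_apply, Fintype.sum_prod_type]
  refine Finset.sum_congr rfl fun j _ => ?_
  rw [Finset.sum_eq_single q.2]
  · rw [Matrix.mul_apply, Fintype.sum_prod_type, Finset.sum_mul]
    refine Finset.sum_congr rfl fun i _ => ?_
    rw [Finset.sum_eq_single p.2]
    · simp only [scrambleIsometry, Matrix.kroneckerMap_apply, Matrix.conjTranspose_apply,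
        Matrix.one_apply_eq, mul_one, Matrix.submatrix_apply, id, tensorPow, Matrix.of_apply,
        entryMonomial, Finset.prod_mul_distrib, star_prod]
      ring
    · intro c _ hc
      simp [scrambleIsometry, hc.symm]
    · simp
  · intro c _ hc
    simp [scrambleIsometry, hc.symm]
  · simp

/-- Expanding the product of `t` uniform mixtures gives a uniform mixture over tuples of strings. -/
theorem parallel_padAndScramble (V : QU (Fin (n + l + m)))
    (Y : Matrix ((Fin t → Reg (Fin n)) × γ) ((Fin t → Reg (Fin n)) × γ) ℂ) :
    parallel t (padAndScramble n l m V) Y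
      = (Fintype.card (Fin t → Reg (Fin m)) : ℂ)⁻¹ • ∑ σ,
        scramble (V : Op (Fin (n + l + m))) σ Y := by
  have hcard : (Fintype.card (Fin t → Reg (Fin m)) : ℂ) = ((2 : ℂ) ^ m) ^ t := by simp
  ext p q
  rw [Matrix.smul_apply, Matrix.sum_apply, smul_eq_mul, hcard]
  simp only [parallel, Matrix.of_apply, padAndScramble_single, scramble_apply]
  have h : ∀ i j : Fin t → Reg (Fin n), ∏ s, (((2 : ℂ) ^ m)⁻¹ *
      ∑ σ, (V : Op (Fin (n + l + m))) (p.1 s) (padded l (i s) σ) *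
        star ((V : Op (Fin (n + l + m))) (q.1 s) (padded l (j s) σ)))
      = (((2 : ℂ) ^ m) ^ t)⁻¹ * ∑ σ : Fin t → Reg (Fin m), entryMonomial p.1 q.1
        (fun s => padded l (i s) (σ s)) (fun s => padded l (j s) (σ s)) V := by
    intro i j
    rw [Finset.prod_mul_distrib, Finset.prod_const, Finset.card_univ, Fintype.card_fin, inv_pow,
      Finset.prod_univ_sum, Fintype.piFinset_univ]
    rfl
  simp only [h]
  simp only [Finset.mul_sum]
  rw [Finset.sum_comm_cycle]
  refine Finset.sum_congr rfl fun σ _ => Finset.sum_congr rfl fun i _ =>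
    Finset.sum_congr rfl fun j _ => ?_
  ring

/-- An oracle for `U` upgrades ciphertexts under `V` to ciphertexts under `U * V`, so the outermost
factor of the encryption can be left to queries. -/
theorem conjugate_parallel_padAndScramble (U V : QU (Fin (n + l + m)))
    (Y : Matrix ((Fin t → Reg (Fin n)) × γ) ((Fin t → Reg (Fin n)) × γ) ℂ) :
    (tensorPow t (U : Op (Fin (n + l + m))) ⊗ₖ (1 : Matrix γ γ ℂ)) *
        parallel t (padAndScramble n l m V) Y *
        (tensorPow t (U : Op (Fin (n + l + m))) ⊗ₖ (1 : Matrix γ γ ℂ))ᴴ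
      = parallel t (padAndScramble n l m (U * V)) Y := by
  rw [parallel_padAndScramble, parallel_padAndScramble, Matrix.mul_smul, Matrix.smul_mul,
    Matrix.mul_sum, Matrix.sum_mul]
  simp only [conjugate_scramble, Submonoid.coe_mul]

end Encryption

/-! ## Haar-random encryption hides the input -/

/-- Birthday bound, free of division: a union bound over ordered pairs, each of which collides for
at most a `1 / |K|` fraction of the functions. -/
theorem card_not_injective_mul_le (S K : Type) [Fintype S] [DecidableEq S] [Fintype K]
    [DecidableEq K] :
    (Finset.univ.filter fun σ : S → K => ¬ Function.Injective σ).card * Fintype.card K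
      ≤ Fintype.card S ^ 2 * Fintype.card (S → K) := by
  have h1 : ∀ s s' : S, s ≠ s' →
      (Finset.univ.filter fun σ : S → K => σ s = σ s').card * Fintype.card K
        ≤ Fintype.card (S → K) := by
    intro s s' hs
    rw [← Finset.card_univ, ← Finset.card_univ, ← Finset.card_product]
    -- Overwriting the value at `s'` loses nothing on colliding functions: it is still present at
    -- `s`.
    refine Finset.card_le_card_of_injOn (fun x => Function.update x.1 s' x.2)
      (fun _ _ => Finset.mem_coe.2 (Finset.mem_univ _)) ?_
    rintro ⟨σ, v⟩ hσ ⟨τ, w⟩ hτ h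
    simp only [Finset.coe_product, Finset.coe_filter, Finset.mem_univ, true_and, Set.mem_prod,
      Set.mem_ofPred_eq] at hσ hτ
    have hv : v = w := by simpa using congrFun h s'
    have hoff : ∀ u, u ≠ s' → σ u = τ u := fun u hu => by simpa [hu] using congrFun h u
    refine Prod.ext (funext fun u => ?_) hv
    by_cases hu : u = s'
    · rw [hu]
      exact hσ.1.symm.trans ((hoff s hs).trans hτ.1)
    · exact hoff u hu
  have h2 : (Finset.univ.filter fun σ : S → K => ¬ Function.Injective σ) ⊆
      (Finset.univ.filter fun p : S × S => p.1 ≠ p.2).biUnion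
        fun p => Finset.univ.filter fun σ : S → K => σ p.1 = σ p.2 := by
    intro σ hσ
    obtain ⟨s, s', h, hne⟩ := Function.not_injective_iff.1 (Finset.mem_filter.1 hσ).2
    simp only [Finset.mem_biUnion, Finset.mem_filter, Finset.mem_univ, true_and]
    exact ⟨(s, s'), hne, h⟩
  calc _ ≤ (∑ p ∈ Finset.univ.filter fun p : S × S => p.1 ≠ p.2,
        (Finset.univ.filter fun σ : S → K => σ p.1 = σ p.2).card) * Fintype.card K :=
        Nat.mul_le_mul_right _ ((Finset.card_le_card h2).trans Finset.card_biUnion_le)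
    _ ≤ ∑ p ∈ Finset.univ.filter fun p : S × S => p.1 ≠ p.2, Fintype.card (S → K) := by
        rw [Finset.sum_mul]
        exact Finset.sum_le_sum fun p hp => h1 p.1 p.2 (Finset.mem_filter.1 hp).2
    _ ≤ _ := by
        rw [Finset.sum_const, smul_eq_mul]
        refine Nat.mul_le_mul_right _ ((Finset.card_le_univ _).trans ?_)
        rw [Fintype.card_prod, sq]

/-! ### Linear functionals and entrywise Haar integrals -/

section Functionals

variable {ι : Type} [Fintype ι] [DecidableEq ι] {α : Type} [Fintype α] [DecidableEq α]

theorem linearMap_apply_eq_sum (F : Matrix α α ℂ →ₗ[ℂ] ℂ) (M : Matrix α α ℂ) :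
    F M = ∑ p, ∑ q, M p q * F (Matrix.single p q 1) := by
  conv_lhs => rw [Matrix.matrix_eq_sum_single M]
  simp only [map_sum]
  refine Finset.sum_congr rfl fun p _ => Finset.sum_congr rfl fun q _ => ?_
  rw [← smul_eq_mul, ← map_smul, Matrix.smul_single, smul_eq_mul, mul_one]

theorem continuous_linearMap_comp (F : Matrix α α ℂ →ₗ[ℂ] ℂ) {f : QU ι → Matrix α α ℂ}
    (hf : ∀ p q, Continuous fun U => f U p q) : Continuous fun U => F (f U) := by
  simp only [linearMap_apply_eq_sum F (f _)]
  exact continuous_finsetSum _ fun p _ => continuous_finsetSum _ fun q _ =>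
    (hf p q).mul continuous_const

theorem integral_linearMap_comp (F : Matrix α α ℂ →ₗ[ℂ] ℂ) {f : QU ι → Matrix α α ℂ}
    (hf : ∀ p q, Continuous fun U => f U p q) :
    ∫ U, F (f U) ∂haarUnitary ι
      = ∑ p, ∑ q, (∫ U, f U p q ∂haarUnitary ι) * F (Matrix.single p q 1) := by
  simp only [linearMap_apply_eq_sum F (f _)]
  have hint : ∀ p q, Integrable (fun U => f U p q * F (Matrix.single p q 1)) (haarUnitary ι) :=
    fun p q => ((hf p q).mul continuous_const).integrable_haarUnitary
  rw [integral_finsetSum _ fun p _ => integrable_finsetSum _ fun q _ => hint p q]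
  refine Finset.sum_congr rfl fun p _ => ?_
  rw [integral_finsetSum _ fun q _ => hint p q]
  exact Finset.sum_congr rfl fun q _ => integral_mul_const _ _

end Functionals

/-! ### Indistinguishability of inputs under a Haar-random encryption -/

section HaarEncryption

variable {n l m t : ℕ}

theorem continuous_scramble_apply {γ : Type} [Fintype γ] [DecidableEq γ] (σ : Fin t → Reg (Fin m))
    (Y : Matrix ((Fin t → Reg (Fin n)) × γ) ((Fin t → Reg (Fin n)) × γ) ℂ)
    (p q : (Fin t → Reg (Fin (n + l + m))) × γ) :
    Continuous fun U : QU (Fin (n + l + m)) => scramble (U : Op (Fin (n + l + m))) σ Y p q := by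
  simp only [scramble_apply]
  exact continuous_finsetSum _ fun i _ => continuous_finsetSum _ fun j _ =>
    continuous_const.mul (continuous_entryMonomial _ _ _ _)

/-- For distinct mixing strings, the average ciphertext depends only on the reference. -/
theorem integral_scramble_apply {γ : Type} [Fintype γ] [DecidableEq γ] {σ : Fin t → Reg (Fin m)}
    (hσ : Function.Injective σ)
    (Y : Matrix ((Fin t → Reg (Fin n)) × γ) ((Fin t → Reg (Fin n)) × γ) ℂ)
    (p q : (Fin t → Reg (Fin (n + l + m))) × γ) :
    ∫ U : QU (Fin (n + l + m)), scramble (U : Op (Fin (n + l + m))) σ Y p q ∂haarUnitary _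
      = (∑ i, Y (i, p.2) (i, q.2)) *
        ∫ U : QU (Fin (n + l + m)), entryMonomial p.1 q.1
          (fun s => padded l (fun _ : Fin n => false) (σ s))
          (fun s => padded l (fun _ : Fin n => false) (σ s)) (U : Op (Fin (n + l + m)))
          ∂haarUnitary _ := by
  have hinj : ∀ i : Fin t → Reg (Fin n), Function.Injective fun s => padded l (i s) (σ s) :=
    -- Distinct mixing strings keep the columns distinct whatever the inputs are, even repeated
    -- ones.
    fun i s s' h => hσ (padded_inj.1 h).2
  have hint : ∀ i j : Fin t → Reg (Fin n), Integrable (fun U : QU (Fin (n + l + m)) =>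
      Y (i, p.2) (j, q.2) * entryMonomial p.1 q.1 (fun s => padded l (i s) (σ s))
        (fun s => padded l (j s) (σ s)) (U : Op (Fin (n + l + m)))) (haarUnitary _) :=
    fun i j => (continuous_const.mul (continuous_entryMonomial _ _ _ _)).integrable_haarUnitary
  simp only [scramble_apply]
  rw [integral_finsetSum _ fun i _ => integrable_finsetSum _ fun j _ => hint i j, Finset.sum_mul]
  refine Finset.sum_congr rfl fun i _ => ?_
  -- Only `j = i` survives; its moment equals that of the all-zero input and so factors out of the
  -- sum over `i`.
  rw [integral_finsetSum _ fun j _ => hint i j, Finset.sum_eq_single i, integral_const_mul]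
  · rw [integral_entryMonomial_diag p.1 q.1 _ _ (hinj i) (hinj fun _ _ => false)]
  · intro j _ hj
    rw [integral_const_mul, integral_entryMonomial_eq_zero _ _ _ _ (hinj i), mul_zero]
    · exact fun s s' h => hσ (padded_inj.1 h).2
    · exact fun h => hj (funext fun s => (padded_inj.1 (congrFun h s)).1.symm)
  · simp

variable {r : ℕ}

theorem outputProb_flatten_eq_re {z : ℕ} (A : Algorithm Gate ((Fin t × Fin z) ⊕ Fin r)) (b : Bool) :
    ∃ F : Matrix ((Fin t → Reg (Fin z)) × Reg (Fin r)) ((Fin t → Reg (Fin z)) × Reg (Fin r)) ℂ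
      →ₗ[ℂ] ℂ, ∀ X, A.outputProb Gate.op (flatten X) b = (F X).re :=
  ⟨A.outputFunctional Gate.op b ∘ₗ (Matrix.reindexLinearEquiv ℂ ℂ (flattenEquiv t z r).symm
    (flattenEquiv t z r).symm).toLinearMap, fun X => A.outputProb_eq_re Gate.op (flatten X) b⟩

variable (A : Algorithm Gate ((Fin t × Fin (n + l + m)) ⊕ Fin r))

theorem continuous_outputProb_scramble (σ : Fin t → Reg (Fin m)) (b : Bool)
    (Y : Matrix ((Fin t → Reg (Fin n)) × Reg (Fin r)) ((Fin t → Reg (Fin n)) × Reg (Fin r)) ℂ) :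
    Continuous fun U : QU (Fin (n + l + m)) =>
      A.outputProb Gate.op (flatten (scramble (U : Op (Fin (n + l + m))) σ Y)) b := by
  obtain ⟨F, hF⟩ := outputProb_flatten_eq_re A b
  simp only [hF]
  exact Complex.continuous_re.comp
    (continuous_linearMap_comp F fun p q => continuous_scramble_apply σ Y p q)

theorem integral_outputProb_scramble_eq {σ : Fin t → Reg (Fin m)} (hσ : Function.Injective σ)
    (b : Bool)
    {Y Y' : Matrix ((Fin t → Reg (Fin n)) × Reg (Fin r)) ((Fin t → Reg (Fin n)) × Reg (Fin r)) ℂ}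
    (h : ∀ p q, ∑ i, Y (i, p) (i, q) = ∑ i, Y' (i, p) (i, q)) :
    ∫ U : QU (Fin (n + l + m)),
        A.outputProb Gate.op (flatten (scramble (U : Op (Fin (n + l + m))) σ Y)) b ∂haarUnitary _
      = ∫ U : QU (Fin (n + l + m)),
        A.outputProb Gate.op (flatten (scramble (U : Op (Fin (n + l + m))) σ Y')) b
          ∂haarUnitary _ := by
  obtain ⟨F, hF⟩ := outputProb_flatten_eq_re A b
  have hre : ∀ Y : Matrix ((Fin t → Reg (Fin n)) × Reg (Fin r))
      ((Fin t → Reg (Fin n)) × Reg (Fin r)) ℂ,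
      ∫ U : QU (Fin (n + l + m)), (F (scramble (U : Op (Fin (n + l + m))) σ Y)).re ∂haarUnitary _
      = (∫ U : QU (Fin (n + l + m)), F (scramble (U : Op (Fin (n + l + m))) σ Y)
          ∂haarUnitary _).re := fun Y =>
    integral_re (continuous_linearMap_comp F fun p q =>
      continuous_scramble_apply σ Y p q).integrable_haarUnitary
  simp only [hF, hre]
  congr 1
  rw [integral_linearMap_comp F fun p q => continuous_scramble_apply σ Y p q,
    integral_linearMap_comp F fun p q => continuous_scramble_apply σ Y' p q]
  simp only [integral_scramble_apply hσ, h]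

/-- The probability of output `b` on `t` states encrypted with the same unitary. -/
def encryptedProb (b : Bool)
    (Y : Matrix ((Fin t → Reg (Fin n)) × Reg (Fin r)) ((Fin t → Reg (Fin n)) × Reg (Fin r)) ℂ)
    (U : QU (Fin (n + l + m))) : ℝ :=
  A.outputProb Gate.op (flatten (parallel t (padAndScramble n l m U) Y)) b

theorem flatten_average {z : ℕ} {K : Type} [Fintype K]
    (X : K → Matrix ((Fin t → Reg (Fin z)) × Reg (Fin r)) ((Fin t → Reg (Fin z)) × Reg (Fin r)) ℂ) :
    flatten ((Fintype.card K : ℂ)⁻¹ • ∑ k, X k) = (Fintype.card K : ℂ)⁻¹ • ∑ k, flatten (X k) := by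
  ext x y
  simp only [flatten_eq_submatrix, Matrix.submatrix_apply, Matrix.smul_apply, Matrix.sum_apply]

theorem encryptedProb_eq_average (b : Bool)
    (Y : Matrix ((Fin t → Reg (Fin n)) × Reg (Fin r)) ((Fin t → Reg (Fin n)) × Reg (Fin r)) ℂ)
    (U : QU (Fin (n + l + m))) :
    encryptedProb A b Y U = keyAverage fun σ : Fin t → Reg (Fin m) =>
      A.outputProb Gate.op (flatten (scramble (U : Op (Fin (n + l + m))) σ Y)) b := by
  rw [encryptedProb, parallel_padAndScramble, flatten_average, Algorithm.outputProb_average]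

theorem continuous_encryptedProb (b : Bool)
    (Y : Matrix ((Fin t → Reg (Fin n)) × Reg (Fin r)) ((Fin t → Reg (Fin n)) × Reg (Fin r)) ℂ) :
    Continuous (encryptedProb A b Y) := by
  have h : encryptedProb A b Y = _ := funext fun U => encryptedProb_eq_average A b Y U
  rw [h]
  exact (continuous_finsetSum _ fun σ _ => continuous_outputProb_scramble A σ b Y).div_const _

theorem integral_keyAverage {ι K : Type} [Fintype ι] [DecidableEq ι] [Fintype K]
    {f : K → QU ι → ℝ} (hf : ∀ k, Continuous (f k)) :
    ∫ U, keyAverage (fun k => f k U) ∂haarUnitary ι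
      = keyAverage fun k => ∫ U, f k U ∂haarUnitary ι := by
  simp only [keyAverage]
  rw [integral_div, integral_finsetSum _ fun k _ => (hf k).integrable_haarUnitary]

/-- Injective tuples of strings contribute nothing to the difference, the others at most `1` each,
and their proportion is given by the birthday bound. -/
theorem abs_integral_encryptedProb_sub_le (b : Bool)
    {Y Y' : Matrix ((Fin t → Reg (Fin n)) × Reg (Fin r)) ((Fin t → Reg (Fin n)) × Reg (Fin r)) ℂ}
    (hY : IsDensity Y) (hY' : IsDensity Y')
    (h : ∀ p q, ∑ i, Y (i, p) (i, q) = ∑ i, Y' (i, p) (i, q)) :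
    |∫ U, encryptedProb A b Y U ∂haarUnitary (Fin (n + l + m))
        - ∫ U, encryptedProb A b Y' U ∂haarUnitary (Fin (n + l + m))|
      ≤ ((t * t : ℕ) : ℝ) * (2 ^ m)⁻¹ := by
  classical
  set a := fun (Y : Matrix ((Fin t → Reg (Fin n)) × Reg (Fin r))
    ((Fin t → Reg (Fin n)) × Reg (Fin r)) ℂ) (σ : Fin t → Reg (Fin m)) =>
    ∫ U : QU (Fin (n + l + m)), A.outputProb Gate.op
      (flatten (scramble (U : Op (Fin (n + l + m))) σ Y)) b ∂haarUnitary _ with ha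
  have ha01 : ∀ {Y}, IsDensity Y → ∀ σ, 0 ≤ a Y σ ∧ a Y σ ≤ 1 := by
    intro Y hY σ
    have hd : ∀ U : QU (Fin (n + l + m)),
        IsDensity (flatten (scramble (U : Op (Fin (n + l + m))) σ Y)) :=
      fun U => (hY.scramble U σ).submatrix_equiv (flattenEquiv _ _ _)
    refine ⟨integral_nonneg fun U => A.outputProb_nonneg _ (hd U).1 b, ?_⟩
    calc a Y σ ≤ ∫ _, (1 : ℝ) ∂haarUnitary (Fin (n + l + m)) :=
          integral_mono (continuous_outputProb_scramble A σ b Y).integrable_haarUnitary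
            (integrable_const _) fun U =>
              A.outputProb_le_one _ Gate.op_mem_unitaryGroup (hd U) b
      _ = 1 := by simp
  have havg : ∀ Y, ∫ U, encryptedProb A b Y U ∂haarUnitary (Fin (n + l + m))
      = (∑ σ, a Y σ) / Fintype.card (Fin t → Reg (Fin m)) := by
    intro Y
    simp only [encryptedProb_eq_average]
    exact integral_keyAverage fun σ => continuous_outputProb_scramble A σ b Y
  have hbound : ∀ σ, |a Y σ - a Y' σ| ≤ if ¬ Function.Injective σ then 1 else 0 := by
    intro σ
    split_ifs with hσ
    · rw [ha]
      simp only
      rw [integral_outputProb_scramble_eq A hσ b h, sub_self, abs_zero]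
    · rw [abs_le]
      constructor <;> linarith [ha01 hY σ, ha01 hY' σ]
  have hN : (0 : ℝ) < Fintype.card (Fin t → Reg (Fin m)) := by exact_mod_cast Fintype.card_pos
  rw [havg, havg, ← sub_div, ← Finset.sum_sub_distrib, abs_div, abs_of_pos hN, div_le_iff₀ hN]
  have hcard := card_not_injective_mul_le (Fin t) (Reg (Fin m))
  rw [Fintype.card_fin, sq] at hcard
  have hm : Fintype.card (Reg (Fin m)) = 2 ^ m := by simp
  rw [hm] at hcard
  calc |∑ σ, (a Y σ - a Y' σ)|
      ≤ ∑ σ : Fin t → Reg (Fin m), if ¬ Function.Injective σ then (1 : ℝ) else 0 :=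
        (Finset.abs_sum_le_sum_abs _ _).trans (Finset.sum_le_sum fun σ _ => hbound σ)
    _ = ((Finset.univ.filter fun σ : Fin t → Reg (Fin m) => ¬ Function.Injective σ).card : ℝ) :=
        Finset.sum_boole _ _
    _ ≤ _ := by
        rw [mul_right_comm, ← div_eq_mul_inv, le_div_iff₀ (by positivity)]
        exact_mod_cast hcard

end HaarEncryption

/-! ## The reduction -/

section Reduction

variable {n l m t r : ℕ}

theorem IsDensity.parallel_padAndScramble
    {Y : Matrix ((Fin t → Reg (Fin n)) × Reg (Fin r)) ((Fin t → Reg (Fin n)) × Reg (Fin r)) ℂ}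
    (hY : IsDensity Y) (V : QU (Fin (n + l + m))) :
    IsDensity (parallel t (padAndScramble n l m V) Y) := by
  rw [QCrypto.parallel_padAndScramble]
  exact IsDensity.average fun σ => hY.scramble V σ

/-- A register of `t` blocks of `z` qubits and `r` further qubits, as one block. -/
def wireEquiv (t z r : ℕ) : (Fin t × Fin z) ⊕ Fin r ≃ Fin (t * z + r) :=
  (finProdFinEquiv.sumCongr (Equiv.refl _)).trans finSumFinEquiv

theorem Algorithm.size_relabel_afterQueries {z : ℕ}
    (A : Algorithm Gate ((Fin t × Fin z) ⊕ Fin r)) :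
    (A.afterQueries.relabel (wireEquiv t z r)).size = A.size + t := by
  simp only [size, relabel, afterQueries, List.length_map, List.length_append,
    List.length_finRange]
  omega

/-- Right invariance makes every key give the same integral; it removes `V₂ V₃` in the Haar world.
-/
theorem integral_keyAverage_mul_right {ι K : Type} [Fintype ι] [DecidableEq ι] [Fintype K]
    [Nonempty K] {f : QU ι → ℝ} (hf : Continuous f) (W : K → QU ι) :
    ∫ U, keyAverage (fun k => f (U * W k)) ∂haarUnitary ι = ∫ U, f U ∂haarUnitary ι := by
  rw [integral_keyAverage (f := fun k U => f (U * W k))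
    fun k => hf.comp (continuous_mul_const (W k))]
  simp only [integral_mul_right_eq_self f]
  rw [keyAverage, Finset.sum_const, nsmul_eq_mul, Finset.card_univ, mul_div_cancel_left₀]
  exact_mod_cast Fintype.card_ne_zero

/-- Querying the oracle on an average of partially encrypted states completes the encryption. -/
theorem outputProb_relabel_afterQueries {K : Type} [Fintype K]
    (A : Algorithm Gate ((Fin t × Fin (n + l + m)) ⊕ Fin r)) (b : Bool)
    (Y : Matrix ((Fin t → Reg (Fin n)) × Reg (Fin r)) ((Fin t → Reg (Fin n)) × Reg (Fin r)) ℂ)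
    (W : K → QU (Fin (n + l + m))) (U : QU (Fin (n + l + m))) :
    (A.afterQueries.relabel (wireEquiv t (n + l + m) r)).outputProb (OracleGate.op U)
        ((flatten ((Fintype.card K : ℂ)⁻¹ •
          ∑ k, parallel t (padAndScramble n l m (W k)) Y)).submatrix
          (regEquiv (wireEquiv t (n + l + m) r)) (regEquiv (wireEquiv t (n + l + m) r))) b
      = keyAverage fun k => encryptedProb A b Y (U * W k) := by
  rw [Algorithm.outputProb_relabel, flatten_average, Algorithm.outputProb_average]
  simp only [Algorithm.outputProb_afterQueries, conjugate_parallel_padAndScramble, encryptedProb]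

end Reduction

/-! ### The adversary against the pseudorandom unitary, and the hybrid bound -/

namespace CPAAdversary

variable {P : PQAS} (A : CPAAdversary P)

/-- The state that is encrypted, and the reference, if the bit is `b`. -/
def selected (n : ℕ) (b : Bool) :
    Matrix ((Fin (A.t n) → Reg (Fin n)) × Reg (Fin (A.r n)))
      ((Fin (A.t n) → Reg (Fin n)) × Reg (Fin (A.r n))) ℂ :=
  selectInput b (A.state n)

theorem selected_density (n : ℕ) (b : Bool) : IsDensity (A.selected n b) :=
  (A.state_density n).selectInput b

/-- The oracle adversary against `V₁` that holds the inputs, scrambled by `V₂` and `V₃` with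
uniformly random keys, as its advice. -/
def oracleAdversary (b : Bool) : OracleAdversary fun n => n + P.tag n + P.mix n where
  wires n := A.t n * (n + P.tag n + P.mix n) + A.r n
  -- Averaging over the keys of `V₂` and `V₃` happens inside the advice. Advice states are
  -- arbitrary, so no circuit has to prepare this one; only its number of qubits must be polynomial.
  advice n := (flatten ((Fintype.card (Reg (Fin (P.len₂ n)) × Reg (Fin (P.len₃ n))) : ℂ)⁻¹ •
    ∑ k : Reg (Fin (P.len₂ n)) × Reg (Fin (P.len₃ n)),
      parallel (A.t n) (padAndScramble n (P.tag n) (P.mix n) (P.V₂ n k.1 * P.V₃ n k.2))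
        (A.selected n b))).submatrix (regEquiv (wireEquiv _ _ _)) (regEquiv (wireEquiv _ _ _))
  advice_density n :=
    ((IsDensity.average fun _ => (A.selected_density n b).parallel_padAndScramble _).submatrix_equiv
      (flattenEquiv _ _ _)).submatrix_equiv (regEquiv (wireEquiv _ _ _))
  alg n := Algorithm.relabel (wireEquiv _ _ _)
    (Algorithm.afterQueries (z := n + P.tag n + P.mix n) (A.alg n))
  wires_poly :=
    (A.t_poly.mul ((PolyBounded.id.add P.tag_poly).add P.mix_poly)).add A.r_poly
  alg_poly := by
    exact (A.alg_poly.add A.t_poly).mono fun n => (Algorithm.size_relabel_afterQueries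
      (z := n + P.tag n + P.mix n) (A.alg n)).le

theorem oracleAdversary_accept (b : Bool) (n : ℕ) (U : QU (Fin (n + P.tag n + P.mix n))) :
    (A.oracleAdversary b).accept n U
      = keyAverage fun k : Reg (Fin (P.len₂ n)) × Reg (Fin (P.len₃ n)) =>
        encryptedProb (l := P.tag n) (m := P.mix n) (A.alg n) true (A.selected n b)
          (U * (P.V₂ n k.1 * P.V₃ n k.2)) :=
  outputProb_relabel_afterQueries (l := P.tag n) (m := P.mix n) (A.alg n) true (A.selected n b)
    (fun k : Reg (Fin (P.len₂ n)) × Reg (Fin (P.len₃ n)) => P.V₂ n k.1 * P.V₃ n k.2) U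

/-- With the pseudorandom oracle the reduction reproduces the real experiment: averaging over `k₁`
and over the pair in the advice is averaging over the whole key. -/
theorem keyAverage_accept (b : Bool) (n : ℕ) :
    keyAverage (fun k => (A.oracleAdversary b).accept n (P.V₁ n k)) = A.outputProb n b true := by
  simp only [oracleAdversary_accept, ← mul_assoc]
  rw [outputProb, keyAverage_prod]
  simp only [parallel_leftRight]
  rfl

theorem integral_accept (b : Bool) (n : ℕ) :
    ∫ U, (A.oracleAdversary b).accept n U ∂haarUnitary (Fin (n + P.tag n + P.mix n))
      = ∫ U, encryptedProb (l := P.tag n) (m := P.mix n) (A.alg n) true (A.selected n b) U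
        ∂haarUnitary (Fin (n + P.tag n + P.mix n)) := by
  simp only [oracleAdversary_accept]
  exact integral_keyAverage_mul_right (continuous_encryptedProb _ _ _)
    fun k : Reg (Fin (P.len₂ n)) × Reg (Fin (P.len₃ n)) => P.V₂ n k.1 * P.V₃ n k.2

/-- Hybrid argument: real left, Haar left, Haar right, real right. The outer steps are
pseudorandomness for the two reductions, the middle one is the Haar bound. -/
theorem advantage_decaysFast : DecaysFast A.advantage := by
  have hpru : ∀ b, DecaysFast fun n =>
      |keyAverage (fun k => (A.oracleAdversary b).accept n (P.V₁ n k))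
        - ∫ U, (A.oracleAdversary b).accept n U ∂haarUnitary (Fin (n + P.tag n + P.mix n))| :=
    fun b => (P.pru.pseudorandom (A.oracleAdversary b)).decaysFast P.pru.poly_lam
  have hhaar := P.mix_superlog.decaysFast (A.t_poly.mul A.t_poly)
  refine (((hpru false).add (hpru true)).add hhaar).mono fun n => ?_
  have h := abs_integral_encryptedProb_sub_le (l := P.tag n) (m := P.mix n) (A.alg n) true
    (A.selected_density n false) (A.selected_density n true) fun p q =>
      (sum_selectInput false (A.state n) p q).trans (sum_selectInput true (A.state n) p q).symm
  simp only [keyAverage_accept, integral_accept, advantage]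
  set x := A.outputProb n false true
  set y := A.outputProb n true true
  set u := ∫ U, encryptedProb (l := P.tag n) (m := P.mix n) (A.alg n) true (A.selected n false) U
    ∂haarUnitary (Fin (n + P.tag n + P.mix n))
  set v := ∫ U, encryptedProb (l := P.tag n) (m := P.mix n) (A.alg n) true (A.selected n true) U
    ∂haarUnitary (Fin (n + P.tag n + P.mix n))
  calc |x - y| = |(x - u) + (v - y) + (u - v)| := by ring_nf
    _ ≤ |x - u| + |v - y| + |u - v| := abs_add_three _ _ _
    _ ≤ _ := by
      rw [abs_sub_comm v y]
      gcongr

theorem outputProb_add_eq_one (n : ℕ) (b : Bool) :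
    A.outputProb n b false + A.outputProb n b true = 1 := by
  simp only [outputProb, keyAverage]
  rw [← add_div, ← Finset.sum_add_distrib, div_eq_one_iff_eq
    (by exact_mod_cast Fintype.card_ne_zero)]
  rw [Finset.sum_congr rfl fun k _ => (A.alg n).outputProb_add_eq_one Gate.op
    Gate.op_mem_unitaryGroup (ρ := flatten (parallel (A.t n) (leftRight (P.encrypt n k) b)
      (A.state n))) ?_]
  · simp
  · rw [parallel_leftRight]
    exact ((A.selected_density n b).parallel_padAndScramble (P.unitary n k)).submatrix_equiv
      (flattenEquiv _ _ _)

/-- Since the two outputs have total probability `1`, the success probability is `1/2` plus half the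
signed advantage; the factor one half is given away. -/
theorem successProb_le (n : ℕ) : A.successProb n ≤ 1 / 2 + A.advantage n := by
  have h1 := A.outputProb_add_eq_one n false
  have h2 : A.outputProb n true true - A.outputProb n false true ≤ A.advantage n :=
    (le_abs_self _).trans_eq (abs_sub_comm _ _)
  have h3 : 0 ≤ A.advantage n := abs_nonneg _
  rw [successProb, Fintype.sum_bool]
  linarith

end CPAAdversary

end QCrypto

end

theorem mainTheorem3 (P : QCrypto.PQAS) (A : QCrypto.CPAAdversary P) :
    QCrypto.NegligibleIn P.lam A.advantage ∧
      ∃ μ : ℕ → ℝ, QCrypto.Negligible μ ∧ ∀ n, A.successProb n ≤ 1 / 2 + μ (P.lam n) := by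
  obtain ⟨p, hp⟩ := P.pru.poly_lam
  -- The PRU bounds `n` by a polynomial in `len₁ n`; monotonicity of the polynomial transfers this
  -- to the full key length.
  have hlen : ∀ n, P.len₁ n ≤ P.lam n := fun n => by
    unfold QCrypto.PQAS.lam
    omega
  have h : QCrypto.NegligibleIn P.lam A.advantage :=
    A.advantage_decaysFast.negligibleIn (fun n => abs_nonneg _) P.key_poly
      ⟨p, fun n => (hp n).trans (QCrypto.monotone_eval p (hlen n))⟩
  obtain ⟨μ, hμ, hle⟩ := h
  exact ⟨⟨μ, hμ, hle⟩, μ, hμ, fun n =>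
    (A.successProb_le n).trans (add_le_add_right (hle n) _)⟩
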